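/- Let $k,d\in\mathbb N$, let $0<\vartheta_1<\dots<\vartheta_d$ be real numbers, $\Theta_d=\{\vartheta_1,\dots,\vartheta_d\}$, and for $\mathbf y\in\mathbb N_0^k$, $\boldsymbol\theta\in(0,\infty)^k$ let $$k(\mathbf y\mid\boldsymbol\theta)=\prod_{j=1}^k e^{-\theta_j}\frac{\theta_j^{y_j}}{y_j!}.$$ For a probability mass function $g$ on the product grid $\Theta_d^k$ put $p_g(\mathbf y)=\sum_{\boldsymbol\vartheta\in\Theta_d^k}k(\mathbf y\mid\boldsymbol\vartheta)\,g(\boldsymbol\vartheta)$, and let $\hat{\boldsymbol\theta}_g(\mathbf y)\in\mathbb R^k$ be the vector of posterior means, with coordinates $$\hat\theta_{g,j}(\mathbf y)=(y_j+1)\frac{p_g(\mathbf y+\mathbf e_j)}{p_g(\mathbf y)},\qquad j=1,\dots,k,$$ where $\mathbf e_j$ is the $j$-th unit vector. Let $G^*$ be a probability measure whose support is the full product grid $\Theta_d^k$, with probability mass function $g^*$. Let $\mathbb P$ be a probability measure under which the true Poisson compound model with oracle prior $G^*$ holds: the unobserved random vectors $(\boldsymbol\theta^*_n)_{n\ge1}$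 are i.i.d. with law $G^*$; for each $n$, given $\boldsymbol\theta^*_n$, the observation $\mathbf Y_n\in\mathbb N_0^k$ has independent coordinates, the $j$-th being Poisson with parameter $\theta^*_{n,j}$; and the observations $(\mathbf Y_n)_{n\ge1}$ are independent (hence i.i.d. with probability mass function $p_{g^*}$). Let $g_0$ be a probability mass function on $\Theta_d^k$ with $g_0(\boldsymbol\vartheta)>0$ for every $\boldsymbol\vartheta\in\Theta_d^k$, let $\alpha_n=(\alpha+n)^{-\gamma}$ for $n\ge1$, with $\alpha>0$ and $\gamma\in(1/2,1)$, and let $(g_n)_{n\ge0}$ be given by Newton's algorithm $$g_{n+1}(\boldsymbol\vartheta)=(1-\alpha_{n+1})\,g_n(\boldsymbol\vartheta)+\alpha_{n+1}\frac{k(\mathbf Y_{n+1}\mid\boldsymbol\vartheta)\,g_n(\boldsymbol\vartheta)}{p_{g_n}(\mathbf Y_{n+1})},\qquad \boldsymbol\vartheta\in\Theta_d^k,\ n\ge0.$$ Define the regret $$\mathrm{Regret}(g_n,g^*)=\sum_{\mathbf y\in\mathbb N_0^k}\big\|\hat{\boldsymbol\theta}_{g_n}(\mathbf y)-\hat{\boldsymbol\theta}_{g^*}(\mathbf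 y)\big\|^2\,p_{g^*}(\mathbf y),$$ with $\|\cdot\|$ the Euclidean norm. Then for every $\delta<2-1/\gamma$, $\mathbb P$-almost surely, $\mathrm{Regret}(g_n,g^*)$ is finite for every $n$ and $$\mathrm{Regret}(g_n,g^*)=o(n^{-\delta})\qquad(n\to\infty).$$ -/

import Mathlib

open MeasureTheory ProbabilityTheory Filter Asymptotics
open scoped NNReal Topology

noncomputable section

namespace PoissonCompound

variable {k d : ℕ}

/-- The `k`-dimensional coordinate-wise independent Poisson kernel
`k(y ∣ θ) = ∏ j, exp (-θ j) * θ j ^ y j / (y j)!`. -/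
def kern (y : Fin k → ℕ) (θ : Fin k → ℝ≥0) : ℝ :=
  ∏ j, Real.exp (-(θ j : ℝ)) * (θ j : ℝ) ^ y j / (Nat.factorial (y j) : ℝ)

/-- The point `(ϑ (t 1), …, ϑ (t k))` of the product grid `Θ_d ^ k`, where `Θ_d = {ϑ 1, …, ϑ d}`.
The `D = d ^ k` points of the product grid are indexed by `t : Fin k → Fin d`. -/
def gridPoint (ϑ : Fin d → ℝ≥0) (t : Fin k → Fin d) : Fin k → ℝ≥0 :=
  fun j => ϑ (t j)

/-- The mixture `p_g(y) = ∑ t, k(y ∣ ϑ_t) g(ϑ_t)`, for a function `g` on the product grid. -/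
def mixture (ϑ : Fin d → ℝ≥0) (g : (Fin k → Fin d) → ℝ) (y : Fin k → ℕ) : ℝ :=
  ∑ t, kern y (gridPoint ϑ t) * g t

/-- The estimator, as a vector of Euclidean space, with coordinates
`θ̂_{g, j}(y) = (y j + 1) * p_g(y + e_j) / p_g(y)`. -/
def thetaHat (ϑ : Fin d → ℝ≥0) (g : (Fin k → Fin d) → ℝ) (y : Fin k → ℕ) :
    EuclideanSpace ℝ (Fin k) :=
  WithLp.toLp 2 fun j => ((y j : ℝ) + 1) * mixture ϑ g (y + Pi.single j 1) / mixture ϑ g y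

/-- The coordinates of the estimator are the posterior means of the coordinates of `θ`, given
`Y = y`, when `θ` has probability mass function `g` on the product grid. -/
theorem thetaHat_apply (ϑ : Fin d → ℝ≥0) (g : (Fin k → Fin d) → ℝ) (y : Fin k → ℕ) (j : Fin k) :
    thetaHat ϑ g y j =
      (∑ t, (ϑ (t j) : ℝ) * (kern y (gridPoint ϑ t) * g t)) / mixture ϑ g y := by
  have key : ∀ θ : Fin k → ℝ≥0,
      ((y j : ℝ) + 1) * kern (y + Pi.single j 1) θ = (θ j : ℝ) * kern y θ := by
    intro θ
    unfold kern
    rw [← Finset.mul_prod_erase _ _ (Finset.mem_univ j),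
      ← Finset.mul_prod_erase (Finset.univ) _ (Finset.mem_univ j)]
    have h : ∀ i ∈ Finset.univ.erase j,
        Real.exp (-(θ i : ℝ)) * (θ i : ℝ) ^ (y + Pi.single j 1 : Fin k → ℕ) i /
            (Nat.factorial ((y + Pi.single j 1 : Fin k → ℕ) i) : ℝ) =
          Real.exp (-(θ i : ℝ)) * (θ i : ℝ) ^ y i / (Nat.factorial (y i) : ℝ) := by
      intro i hi
      have hij : i ≠ j := Finset.ne_of_mem_erase hi
      simp [hij]
    rw [Finset.prod_congr rfl h]
    have h1 : (Nat.factorial (y j) : ℝ) ≠ 0 := by positivity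
    have h2 : ((y j : ℝ) + 1) ≠ 0 := by positivity
    simp only [Pi.add_apply, Pi.single_eq_same, Nat.factorial_succ, Nat.cast_mul, Nat.cast_add,
      Nat.cast_one]
    field_simp
    ring
  simp only [thetaHat, mixture, Finset.mul_sum, ← mul_assoc, key]
  rfl

/-- The `y`-th term of the regret:
`‖θ̂_g(y) - θ̂_{g*}(y)‖ ^ 2 * p_{g*}(y)`, with the Euclidean norm. -/
def regretTerm (ϑ : Fin d → ℝ≥0) (g gstar : (Fin k → Fin d) → ℝ) (y : Fin k → ℕ) : ℝ :=
  ‖thetaHat ϑ g y - thetaHat ϑ gstar y‖ ^ 2 * mixture ϑ gstar y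

/-- The regret of using `θ̂_g` instead of the oracle `θ̂_{g*}`. -/
def regret (ϑ : Fin d → ℝ≥0) (g gstar : (Fin k → Fin d) → ℝ) : ℝ :=
  ∑' y : Fin k → ℕ, regretTerm ϑ g gstar y

/-- Newton's algorithm with learning rates `a 1, a 2, …`, initial guess `g₀` and observations
`Y 0, Y 1, …` (so that `Y n` is the `(n + 1)`-st observation):
`g_{n+1}(ϑ_t) = (1 - a (n+1)) g_n(ϑ_t) + a (n+1) k(Y_{n+1} ∣ ϑ_t) g_n(ϑ_t) / p_{g_n}(Y_{n+1})`. -/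
def newton (ϑ : Fin d → ℝ≥0) (a : ℕ → ℝ) (g₀ : (Fin k → Fin d) → ℝ) (Y : ℕ → Fin k → ℕ) :
    ℕ → (Fin k → Fin d) → ℝ
  | 0 => g₀
  | n + 1 => fun t =>
      (1 - a (n + 1)) * newton ϑ a g₀ Y n t +
        a (n + 1) * (kern (Y n) (gridPoint ϑ t) * newton ϑ a g₀ Y n t /
          mixture ϑ (newton ϑ a g₀ Y n) (Y n))

/-- The "true" Poisson compound model with oracle prior `G`: the unobserved parameters `θ n` are
independent with law `G`; given `θ n`, the vector `Y n` has the product of the Poisson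
distributions with parameters `θ n j` as its conditional distribution; the observations `Y n` are
independent of each other. -/
structure IsTrueModel {Ω : Type*} [MeasurableSpace Ω] (P : Measure Ω)
    (G : Measure (Fin k → ℝ≥0)) (θ : ℕ → Ω → Fin k → ℝ≥0) (Y : ℕ → Ω → Fin k → ℕ) : Prop where
  measurable_param : ∀ n, Measurable (θ n)
  measurable_obs : ∀ n, Measurable (Y n)
  law_param : ∀ n, P.map (θ n) = G
  indep_param : iIndepFun θ P
  cond_obs : ∀ n, ∀ A : Set (Fin k → ℝ≥0), MeasurableSet A → ∀ B : Set (Fin k → ℕ),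
    P (θ n ⁻¹' A ∩ Y n ⁻¹' B) =
      ∫⁻ x in A, Measure.pi (fun j => poissonMeasure (x j)) B ∂G
  indep_obs : iIndepFun Y P

/-- The probability mass function, on the product grid, of the prior `G`. -/
def priorPMF (ϑ : Fin d → ℝ≥0) (G : Measure (Fin k → ℝ≥0)) (t : Fin k → Fin d) : ℝ :=
  G.real {gridPoint ϑ t}

end PoissonCompound

end

open PoissonCompound

noncomputable section

namespace PoissonCompound

/-! Write `w` for the oracle prior and follow the Lyapunov function x = exp(KL(w ∣ g)) - 1 along the
algorithm. A Newton step multiplies `g` by 1 + a (K / p_g - 1), so AM-GM and a second-order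
expansion bound the new x by x + (1 + x) (-a m + O(a²)), where m = p_w / p_g - 1. Under p_w the mean
of m is the χ² divergence of the mixtures. Linear independence of the Poisson kernels bounds it
below by a multiple of |w - g|², hence of 1 - exp(-KL). Since (1 + x) (1 - exp(-KL)) = x, the drift
is a linear contraction of x at rate a, uniformly over the simplex.

The noise also shrinks near `w`: m² is at most a constant times ρ² (1 - exp(-KL)), where `ρ` bounds
the ratios of the kernels and has all moments. So E x ^ q contracts at rate c a up to an error of
order a² (1 + x) (x + a) ^ (q - 1), which is absorbed to leave a ^ (q + 1)
(`exists_tsum_newtonStep_le`, `exists_absorb`). Because a varies slowly, E x_n ^ q = O(a_n ^ q) for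
every q ≥ 2 (`exists_lintegral_klExcess_pow_le`).

For δ < γ and q large, ∑ E (n ^ δ x_n) ^ q converges, so n ^ δ x_n → 0 almost surely
(`ae_tendsto_rpow_mul_klExcess`). The regret is at most a constant times x (`exists_regret_le`), and
2 - 1/γ ≤ γ. -/

/-! ### Positive probability mass functions on a finite type -/

/-- A probability mass function on a finite type with no zeros. -/
structure IsPosPMF {T : Type*} [Fintype T] (g : T → ℝ) : Prop where
  pos : ∀ t, 0 < g t
  sum_eq_one : ∑ t, g t = 1

/-- The exponential `∏ t, (g t / w t) ^ w t` of minus the Kullback-Leibler divergence of `w`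
from `g`. -/
def affinity {T : Type*} [Fintype T] (w g : T → ℝ) : ℝ :=
  ∏ t, (g t / w t) ^ w t

/-- The Lyapunov function `exp (KL(w ∣ g)) - 1`. -/
def klExcess {T : Type*} [Fintype T] (w g : T → ℝ) : ℝ :=
  (affinity w g)⁻¹ - 1

section Simplex

variable {T : Type*} [Fintype T] {w g : T → ℝ}

theorem IsPosPMF.le_one (hg : IsPosPMF g) (t : T) : g t ≤ 1 := by
  rw [← hg.sum_eq_one]
  exact Finset.single_le_sum (fun i _ => (hg.pos i).le) (Finset.mem_univ t)

theorem IsPosPMF.nonempty (hg : IsPosPMF g) : Nonempty T := by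
  by_contra h
  rw [not_nonempty_iff] at h
  simpa using hg.sum_eq_one

theorem affinity_pos (hw : IsPosPMF w) (hg : IsPosPMF g) : 0 < affinity w g :=
  Finset.prod_pos fun t _ => Real.rpow_pos_of_pos (div_pos (hg.pos t) (hw.pos t)) _

theorem affinity_le_one (hw : IsPosPMF w) (hg : IsPosPMF g) : affinity w g ≤ 1 := by
  refine (Real.geom_mean_le_arith_mean_weighted Finset.univ w (fun t => g t / w t)
    (fun t _ => (hw.pos t).le) hw.sum_eq_one
    (fun t _ => (div_pos (hg.pos t) (hw.pos t)).le)).trans_eq ?_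
  rw [← hg.sum_eq_one]
  exact Finset.sum_congr rfl fun t _ => mul_div_cancel₀ _ (hw.pos t).ne'

theorem klExcess_nonneg (hw : IsPosPMF w) (hg : IsPosPMF g) : 0 ≤ klExcess w g :=
  sub_nonneg.2 ((one_le_inv₀ (affinity_pos hw hg)).2 (affinity_le_one hw hg))

/-- The reason for exponentiating KL: the drift is only bounded below by the bounded quantity 1 -
exp(-KL), and the factor 1 + x of the multiplicative update turns that into a drift linear in x. -/
theorem one_add_klExcess_mul (hw : IsPosPMF w) (hg : IsPosPMF g) :
    (1 + klExcess w g) * (1 - affinity w g) = klExcess w g := by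
  have := affinity_pos hw hg
  unfold klExcess
  field_simp
  ring

theorem one_sub_affinity_le_klExcess (hw : IsPosPMF w) (hg : IsPosPMF g) :
    1 - affinity w g ≤ klExcess w g := by
  have h1 := one_add_klExcess_mul hw hg
  have h2 := klExcess_nonneg hw hg
  have h3 := affinity_le_one hw hg
  nlinarith

/-- The squared distance is controlled by `1 - exp (-KL)` (through the Hellinger distance). -/
theorem sum_sq_sub_le (hw : IsPosPMF w) (hg : IsPosPMF g) :
    ∑ t, (w t - g t) ^ 2 ≤ 8 * (1 - affinity w g) := by
  set b := ∑ t, √(w t) * √(g t) with hb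
  have hb0 : 0 ≤ b := Finset.sum_nonneg fun t _ => by positivity
  have hroot : ∏ t, √(g t / w t) ^ w t ≤ b := by
    refine (Real.geom_mean_le_arith_mean_weighted Finset.univ w (fun t => √(g t / w t))
      (fun t _ => (hw.pos t).le) hw.sum_eq_one (fun t _ => Real.sqrt_nonneg _)).trans_eq ?_
    refine Finset.sum_congr rfl fun t _ => ?_
    have h0 : 0 < √(w t) := Real.sqrt_pos.2 (hw.pos t)
    rw [Real.sqrt_div' _ (hw.pos t).le]
    nth_rewrite 1 [← Real.mul_self_sqrt (hw.pos t).le]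
    field_simp
  have hsq : affinity w g = (∏ t, √(g t / w t) ^ w t) ^ 2 := by
    rw [← Finset.prod_pow]
    refine Finset.prod_congr rfl fun t _ => ?_
    have h0 : 0 ≤ g t / w t := (div_pos (hg.pos t) (hw.pos t)).le
    rw [← Real.rpow_natCast, ← Real.rpow_mul (Real.sqrt_nonneg _), mul_comm,
      Real.rpow_mul (Real.sqrt_nonneg _), Real.rpow_natCast, Real.sq_sqrt h0]
  have hS : affinity w g ≤ b ^ 2 := by
    rw [hsq]
    exact pow_le_pow_left₀ (Finset.prod_nonneg fun t _ => by positivity) hroot 2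
  have hhell : ∑ t, (√(w t) - √(g t)) ^ 2 = 2 - 2 * b := by
    have : ∀ t, (√(w t) - √(g t)) ^ 2 = w t + g t - 2 * (√(w t) * √(g t)) := fun t => by
      nlinarith [Real.sq_sqrt (hw.pos t).le, Real.sq_sqrt (hg.pos t).le]
    simp_rw [this]
    rw [Finset.sum_sub_distrib, Finset.sum_add_distrib, hw.sum_eq_one, hg.sum_eq_one,
      ← Finset.mul_sum]
    ring
  have hb1 : b ≤ 1 := by
    have : 0 ≤ ∑ t, (√(w t) - √(g t)) ^ 2 := Finset.sum_nonneg fun t _ => sq_nonneg _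
    linarith
  have hle : ∑ t, (w t - g t) ^ 2 ≤ 4 * ∑ t, (√(w t) - √(g t)) ^ 2 := by
    rw [Finset.mul_sum]
    refine Finset.sum_le_sum fun t _ => ?_
    have h1 : √(w t) ≤ 1 := Real.sqrt_le_one.2 (hw.le_one t)
    have h2 : √(g t) ≤ 1 := Real.sqrt_le_one.2 (hg.le_one t)
    have h3 := Real.sqrt_nonneg (w t)
    have h4 := Real.sqrt_nonneg (g t)
    have h5 : (w t - g t) ^ 2 = (√(w t) + √(g t)) ^ 2 * (√(w t) - √(g t)) ^ 2 := by
      rw [← mul_pow, ← sq_sub_sq, Real.sq_sqrt (hw.pos t).le, Real.sq_sqrt (hg.pos t).le]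
    rw [h5]
    exact mul_le_mul_of_nonneg_right (by nlinarith) (sq_nonneg _)
  -- The sum is at most 8 (1 - b); since 0 ≤ b ≤ 1, b² ≤ b, and the affinity is at most b².
  nlinarith

/-- `1 - exp (-KL(w ∣ g))` is at most a constant times the squared distance. -/
theorem exists_one_sub_affinity_le (hw : IsPosPMF w) :
    ∃ C : ℝ, 0 < C ∧ ∀ g, IsPosPMF g → 1 - affinity w g ≤ C * ∑ t, (w t - g t) ^ 2 := by
  have := hw.nonempty
  obtain ⟨t₀, ht₀⟩ := Finite.exists_min w
  set m := w t₀
  have hm : 0 < m := hw.pos t₀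
  refine ⟨2 / m + 4 / m ^ 2, by positivity, fun g hg => ?_⟩
  have hS := affinity_pos hw hg
  set e := ∑ t, (w t - g t) ^ 2 with he
  have he0 : 0 ≤ e := Finset.sum_nonneg fun t _ => sq_nonneg _
  -- If g ≥ w / 2 everywhere, the χ² divergence dominates and its denominators are at least m / 2.
  -- Otherwise the squared distance is at least m² / 4, and 1 - affinity ≤ 1 suffices. The two terms
  -- of the constant serve the two cases.
  by_cases hclose : ∀ t, w t / 2 ≤ g t
  · have hinv : (affinity w g)⁻¹ ≤ ∑ t, w t * (w t / g t) := by
      have h := Real.geom_mean_le_arith_mean_weighted Finset.univ w (fun t => w t / g t)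
        (fun t _ => (hw.pos t).le) hw.sum_eq_one
        (fun t _ => (div_pos (hw.pos t) (hg.pos t)).le)
      refine le_trans (le_of_eq ?_) h
      rw [affinity, ← Finset.prod_inv_distrib]
      refine Finset.prod_congr rfl fun t _ => ?_
      rw [← Real.inv_rpow (div_pos (hg.pos t) (hw.pos t)).le, inv_div]
    have hchi : ∑ t, w t * (w t / g t) = 1 + ∑ t, (w t - g t) ^ 2 / g t := by
      have : ∀ t, w t * (w t / g t) = 2 * w t - g t + (w t - g t) ^ 2 / g t := fun t => by
        have := hg.pos t
        field_simp
        ring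
      simp_rw [this]
      rw [Finset.sum_add_distrib, Finset.sum_sub_distrib, ← Finset.mul_sum, hw.sum_eq_one,
        hg.sum_eq_one]
      ring
    have hle : ∑ t, (w t - g t) ^ 2 / g t ≤ 2 / m * e := by
      rw [he, Finset.mul_sum]
      refine Finset.sum_le_sum fun t _ => ?_
      rw [div_mul_eq_mul_div, div_le_div_iff₀ (hg.pos t) hm]
      have h1 : m ≤ 2 * g t := by linarith [hclose t, ht₀ t]
      nlinarith [sq_nonneg (w t - g t)]
    have h1 : 1 - affinity w g ≤ (affinity w g)⁻¹ - 1 := one_sub_affinity_le_klExcess hw hg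
    have h2 : 0 ≤ 4 / m ^ 2 * e := by positivity
    nlinarith
  · push Not at hclose
    obtain ⟨t, ht⟩ := hclose
    have h1 : m ^ 2 / 4 ≤ e := by
      have h2 : (w t - g t) ^ 2 ≤ e :=
        Finset.single_le_sum (f := fun t => (w t - g t) ^ 2) (fun i _ => sq_nonneg _)
          (Finset.mem_univ t)
      have h3 : m / 2 ≤ w t - g t := by linarith [ht₀ t]
      nlinarith
    have h2 : 1 ≤ 4 / m ^ 2 * e := by
      rw [div_mul_eq_mul_div, le_div_iff₀ (by positivity)]
      linarith
    have h3 : 0 ≤ 2 / m * e := by positivity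
    linarith

/-- The effect on `exp KL` of a multiplicative update. -/
theorem inv_affinity_mul_le (hw : IsPosPMF w) (hg : IsPosPMF g) {u : T → ℝ}
    (hu : ∀ t, 0 < u t) :
    (affinity w fun t => g t * u t)⁻¹ ≤ (affinity w g)⁻¹ * ∑ t, w t * (u t)⁻¹ := by
  have h := Real.geom_mean_le_arith_mean_weighted Finset.univ w (fun t => (u t)⁻¹)
    (fun t _ => (hw.pos t).le) hw.sum_eq_one (fun t _ => (inv_pos.2 (hu t)).le)
  refine le_trans (le_of_eq ?_)
    (mul_le_mul_of_nonneg_left h (inv_pos.2 (affinity_pos hw hg)).le)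
  simp only [affinity]
  rw [← Finset.prod_inv_distrib, ← Finset.prod_inv_distrib, ← Finset.prod_mul_distrib]
  refine Finset.prod_congr rfl fun t _ => ?_
  rw [Real.inv_rpow (hu t).le, ← mul_inv,
    ← Real.mul_rpow (div_pos (hg.pos t) (hw.pos t)).le (hu t).le, mul_div_right_comm]

end Simplex

/-! ### Elementary inequalities -/

/-- The linear term keeps the sign of h, since its mean is what produces the contraction; only the
remainder is bounded in absolute value. -/
theorem add_pow_le_taylor {x h : ℝ} (hx : 0 ≤ x) (hxh : 0 ≤ x + h) (r : ℕ) :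
    (x + h) ^ (r + 2) ≤
      x ^ (r + 2) + (r + 2) * x ^ (r + 1) * h + (r + 2) ^ 2 * (h ^ 2 * (x + |h|) ^ r) := by
  induction r with
  | zero => simp; nlinarith [sq_nonneg h]
  | succ r ih =>
    have h1 : x ≤ x + |h| := by linarith [abs_nonneg h]
    have h2 : x + h ≤ x + |h| := by linarith [le_abs_self h]
    have h3 : x ^ (r + 1) ≤ (x + |h|) ^ (r + 1) := pow_le_pow_left₀ hx h1 _
    have h4 : (x + h) * (x + |h|) ^ r ≤ (x + |h|) ^ (r + 1) := by
      rw [pow_succ']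
      exact mul_le_mul_of_nonneg_right h2 (pow_nonneg (hx.trans h1) _)
    calc (x + h) ^ (r + 1 + 2) = (x + h) * (x + h) ^ (r + 2) := by ring
      _ ≤ (x + h) * (x ^ (r + 2) + (r + 2) * x ^ (r + 1) * h
          + (r + 2) ^ 2 * (h ^ 2 * (x + |h|) ^ r)) := mul_le_mul_of_nonneg_left ih hxh
      _ = x ^ (r + 3) + (r + 3) * x ^ (r + 2) * h + (r + 2) * h ^ 2 * x ^ (r + 1)
          + (r + 2) ^ 2 * h ^ 2 * ((x + h) * (x + |h|) ^ r) := by ring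
      _ ≤ x ^ (r + 3) + (r + 3) * x ^ (r + 2) * h + (r + 2) * h ^ 2 * (x + |h|) ^ (r + 1)
          + (r + 2) ^ 2 * h ^ 2 * (x + |h|) ^ (r + 1) := by gcongr
      _ ≤ _ := by
        have h5 : 0 ≤ h ^ 2 * (x + |h|) ^ (r + 1) := by positivity
        have h6 : (0 : ℝ) ≤ r := r.cast_nonneg
        push_cast
        nlinarith

/-- Absorption of the noise term into the contraction. -/
theorem exists_absorb {c C : ℝ} (hc : 0 < c) (hC : 0 < C) (r : ℕ) :
    ∃ a₀ > 0, ∃ C' > 0, ∀ x a : ℝ, 0 ≤ x → 0 < a → a ≤ a₀ →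
      C * (a ^ 2 * (1 + x) * (x + a) ^ (r + 1)) ≤ c * a * x ^ (r + 2) + C' * a ^ (r + 3) := by
  set K : ℝ := max 1 (C * 2 ^ (r + 2) / c) with hK
  have hK1 : 1 ≤ K := le_max_left _ _
  have hK2 : C * 2 ^ (r + 2) ≤ c * K := by
    rw [mul_comm c, ← div_le_iff₀ hc]
    exact le_max_right _ _
  have hK0 : 0 < K := by linarith
  refine ⟨1 / K, by positivity, C * (1 + K) ^ (r + 2), by positivity, fun x a hx ha ha0 => ?_⟩
  have haK : a * K ≤ 1 := (le_div_iff₀ hK0).1 ha0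
  have ha1 : a ≤ 1 := by nlinarith
  -- Above the threshold x = K a the noise is smaller than the contraction, by a factor governed by
  -- the choice of K; below it x is of order a, and the noise is of order a ^ (r + 3).
  by_cases hxa : K * a ≤ x
  · have h1 : x + a ≤ 2 * x := by nlinarith
    have h2 : (x + a) ^ (r + 1) ≤ 2 ^ (r + 1) * x ^ (r + 1) := by
      rw [← mul_pow]
      exact pow_le_pow_left₀ (by positivity) h1 _
    have h3 : a * (1 + x) * K ≤ 2 * x := by nlinarith
    have h4 : 0 ≤ C * (1 + K) ^ (r + 2) * a ^ (r + 3) := by positivity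
    have h5 : C * (a ^ 2 * (1 + x) * (x + a) ^ (r + 1)) * K ≤ c * a * x ^ (r + 2) * K :=
      calc C * (a ^ 2 * (1 + x) * (x + a) ^ (r + 1)) * K
          ≤ C * (a ^ 2 * (1 + x) * (2 ^ (r + 1) * x ^ (r + 1))) * K := by gcongr
        _ = C * 2 ^ (r + 1) * a * x ^ (r + 1) * (a * (1 + x) * K) := by ring
        _ ≤ C * 2 ^ (r + 1) * a * x ^ (r + 1) * (2 * x) := by gcongr
        _ = C * 2 ^ (r + 2) * (a * x ^ (r + 2)) := by ring
        _ ≤ c * K * (a * x ^ (r + 2)) := by gcongr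
        _ = c * a * x ^ (r + 2) * K := by ring
    linarith [le_of_mul_le_mul_right h5 hK0]
  · push Not at hxa
    have h1 : (x + a) ^ (r + 1) ≤ (1 + K) ^ (r + 1) * a ^ (r + 1) := by
      rw [← mul_pow]
      exact pow_le_pow_left₀ (by positivity) (by linarith) _
    have h2 : 1 + x ≤ 1 + K := by nlinarith
    have h3 : 0 ≤ c * a * x ^ (r + 2) := by positivity
    calc C * (a ^ 2 * (1 + x) * (x + a) ^ (r + 1))
        ≤ C * (a ^ 2 * (1 + K) * ((1 + K) ^ (r + 1) * a ^ (r + 1))) := by gcongr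
      _ = C * (1 + K) ^ (r + 2) * a ^ (r + 3) := by ring
      _ ≤ _ := by linarith

/-! ### Mixtures of a finite family of comparable probability mass functions -/

/-- The mixture of the functions `K · t` with weights `g t`. -/
def mix {S T : Type*} [Fintype T] (K : S → T → ℝ) (g : T → ℝ) (y : S) : ℝ :=
  ∑ t, K y t * g t

/-- One step of Newton's algorithm, with learning rate `a` and observation `y`. -/
def newtonStep {S T : Type*} [Fintype T] (K : S → T → ℝ) (a : ℝ) (g : T → ℝ) (y : S) : T → ℝ :=
  fun t => (1 - a) * g t + a * (K y t * g t / mix K g y)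

/-- The relative error of the mixture with weights `g`, with respect to the weights `w`. -/
def relErr {S T : Type*} [Fintype T] (K : S → T → ℝ) (w g : T → ℝ) (y : S) : ℝ :=
  mix K w y / mix K g y - 1

/-- A finite family of positive, linearly independent probability mass functions whose ratios are
bounded by a function `ρ` with finite moments of all orders. -/
structure RegularKernel {S T : Type*} [Fintype T] (K : S → T → ℝ) (ρ : S → ℝ) : Prop where
  pos : ∀ y t, 0 < K y t
  one_le : ∀ y, 1 ≤ ρ y
  le_mul : ∀ y t t', K y t ≤ ρ y * K y t'
  hasSum : ∀ t, HasSum (fun y => K y t) 1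
  summable_mul_pow : ∀ (n : ℕ) (t : T), Summable fun y => K y t * ρ y ^ n
  identifiable : ∀ v : T → ℝ, (∀ y, mix K v y = 0) → v = 0

section Kernel

variable {S T : Type*} [Fintype T] {K : S → T → ℝ} {ρ : S → ℝ} {w g : T → ℝ}

theorem mix_sub (v v' : T → ℝ) (y : S) : mix K (fun t => v t - v' t) y = mix K v y - mix K v' y := by
  simp only [mix, mul_sub, Finset.sum_sub_distrib]

namespace RegularKernel

theorem mix_pos (hK : RegularKernel K ρ) (hg : IsPosPMF g) (y : S) : 0 < mix K g y := by
  have := hg.nonempty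
  exact Finset.sum_pos (fun t _ => mul_pos (hK.pos y t) (hg.pos t)) Finset.univ_nonempty

theorem hasSum_mix (hK : RegularKernel K ρ) (hg : IsPosPMF g) : HasSum (mix K g) 1 := by
  have h := hasSum_sum (s := Finset.univ) fun t _ => (hK.hasSum t).mul_right (g t)
  simp only [one_mul, hg.sum_eq_one] at h
  exact h

theorem mix_le_one (hK : RegularKernel K ρ) (hg : IsPosPMF g) (y : S) : mix K g y ≤ 1 :=
  le_hasSum (hK.hasSum_mix hg) y fun y' _ => (hK.mix_pos hg y').le

theorem le_one (hK : RegularKernel K ρ) (y : S) (t : T) : K y t ≤ 1 :=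
  le_hasSum (hK.hasSum t) y fun y' _ => (hK.pos y' t).le

/-- Averaging `le_mul` over t' with weights `g` needs no lower bound on `g`. This is why the later
constants are uniform over the open simplex. -/
theorem le_mul_mix (hK : RegularKernel K ρ) (hg : IsPosPMF g) (y : S) (t : T) :
    K y t ≤ ρ y * mix K g y := by
  calc K y t = ∑ t', K y t * g t' := by rw [← Finset.mul_sum, hg.sum_eq_one, mul_one]
    _ ≤ ∑ t', ρ y * (K y t' * g t') := Finset.sum_le_sum fun t' _ => by
        rw [← mul_assoc]
        exact mul_le_mul_of_nonneg_right (hK.le_mul y t t') (hg.pos t').le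
    _ = _ := by rw [mix, Finset.mul_sum]

theorem mix_le_mul_mix (hK : RegularKernel K ρ) (hw : IsPosPMF w) (hg : IsPosPMF g) (y : S) :
    mix K w y ≤ ρ y * mix K g y := by
  calc mix K w y ≤ ∑ t, ρ y * mix K g y * w t := Finset.sum_le_sum fun t _ =>
        mul_le_mul_of_nonneg_right (hK.le_mul_mix hg y t) (hw.pos t).le
    _ = _ := by rw [← Finset.mul_sum, hw.sum_eq_one, mul_one]

theorem summable_mix_mul_pow (hK : RegularKernel K ρ) (w : T → ℝ) (n : ℕ) :
    Summable fun y => mix K w y * ρ y ^ n := by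
  have h := summable_sum (s := Finset.univ) fun t _ => (hK.summable_mul_pow n t).mul_right (w t)
  refine h.congr fun y => ?_
  rw [mix, Finset.sum_mul]
  exact Finset.sum_congr rfl fun t _ => by ring

theorem abs_relErr_le (hK : RegularKernel K ρ) (hw : IsPosPMF w) (hg : IsPosPMF g) (y : S) :
    |relErr K w g y| ≤ ρ y := by
  have h0 := hK.mix_pos hg y
  have h1 : mix K w y / mix K g y ≤ ρ y := (div_le_iff₀ h0).2 (hK.mix_le_mul_mix hw hg y)
  have h2 : 0 < mix K w y / mix K g y := div_pos (hK.mix_pos hw y) h0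
  have h3 := hK.one_le y
  rw [relErr, abs_le]
  constructor <;> linarith

theorem abs_mix_div_mix_le (hK : RegularKernel K ρ) (hg : IsPosPMF g) (v : T → ℝ) (y : S) :
    |mix K v y| / mix K g y ≤ ρ y * ∑ t, |v t| := by
  rw [div_le_iff₀ (hK.mix_pos hg y)]
  calc |mix K v y| ≤ ∑ t, |K y t * v t| := Finset.abs_sum_le_sum_abs _ _
    _ ≤ ∑ t, ρ y * mix K g y * |v t| := Finset.sum_le_sum fun t _ => by
        rw [abs_mul, abs_of_pos (hK.pos y t)]
        exact mul_le_mul_of_nonneg_right (hK.le_mul_mix hg y t) (abs_nonneg _)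
    _ = _ := by rw [← Finset.mul_sum]; ring

theorem relErr_eq (hK : RegularKernel K ρ) (hg : IsPosPMF g) (y : S) :
    relErr K w g y = mix K (fun t => w t - g t) y / mix K g y := by
  have h0 := (hK.mix_pos hg y).ne'
  rw [relErr, mix_sub]
  field_simp

/-- Cauchy-Schwarz and the Hellinger bound `sum_sq_sub_le`. The point is that the noise vanishes
together with the Lyapunov function, which is what gives x the order of a rather than of its square
root. -/
theorem relErr_sq_le (hK : RegularKernel K ρ) (hw : IsPosPMF w) (hg : IsPosPMF g) (y : S) :
    relErr K w g y ^ 2 ≤ 8 * Fintype.card T * ρ y ^ 2 * (1 - affinity w g) := by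
  have h0 := hK.mix_pos hg y
  have h1 : |relErr K w g y| ≤ ρ y * ∑ t, |w t - g t| := by
    rw [hK.relErr_eq hg, abs_div, abs_of_pos h0]
    exact hK.abs_mix_div_mix_le hg _ y
  have h2 : (∑ t, |w t - g t|) ^ 2 ≤ Fintype.card T * ∑ t, (w t - g t) ^ 2 := by
    simpa [sq_abs] using sq_sum_le_card_mul_sum_sq (s := Finset.univ) (f := fun t => |w t - g t|)
  have h3 := sum_sq_sub_le hw hg
  calc relErr K w g y ^ 2 = |relErr K w g y| ^ 2 := (sq_abs _).symm
    _ ≤ (ρ y * ∑ t, |w t - g t|) ^ 2 := pow_le_pow_left₀ (abs_nonneg _) h1 2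
    _ = ρ y ^ 2 * (∑ t, |w t - g t|) ^ 2 := mul_pow _ _ _
    _ ≤ ρ y ^ 2 * (Fintype.card T * (8 * (1 - affinity w g))) := by
        refine mul_le_mul_of_nonneg_left (h2.trans ?_) (sq_nonneg _)
        exact mul_le_mul_of_nonneg_left h3 (Nat.cast_nonneg _)
    _ = _ := by ring

/-- Quantitative identifiability of the weights of a mixture. -/
theorem exists_le_mix_sq [Nonempty T] (hK : RegularKernel K ρ) :
    ∃ c > 0, ∀ v : T → ℝ, ∃ y, c * ∑ t, v t ^ 2 ≤ mix K v y ^ 2 := by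
  -- With the discrete topology, v ↦ mix K v is an injective linear map from a finite-dimensional
  -- space into the bounded functions on S with the sup norm, hence is bounded below.
  let _ : TopologicalSpace S := ⊥
  have : DiscreteTopology S := ⟨rfl⟩
  have hbound : ∀ (v : T → ℝ) (y : S), ‖mix K v y‖ ≤ ∑ t, |v t| := fun v y =>
    (norm_sum_le _ _).trans <| Finset.sum_le_sum fun t _ => by
      rw [norm_mul, Real.norm_eq_abs, Real.norm_eq_abs, abs_of_pos (hK.pos y t)]
      exact mul_le_of_le_one_left (abs_nonneg _) (hK.le_one y t)
  let F : (T → ℝ) →ₗ[ℝ] BoundedContinuousFunction S ℝ :=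
    { toFun := fun v => BoundedContinuousFunction.ofNormedAddCommGroupDiscrete (mix K v) _ (hbound v)
      map_add' := fun v v' => by
        ext y
        simp [mix, mul_add, Finset.sum_add_distrib]
      map_smul' := fun a v => by
        ext y
        simp [mix, Finset.mul_sum, mul_left_comm] }
  have hF : ∀ v y, F v y = mix K v y := fun v y => rfl
  have hker : F.ker = ⊥ := LinearMap.ker_eq_bot'.2 fun v hv =>
    hK.identifiable v fun y => by rw [← hF, hv]; rfl
  obtain ⟨C, hC, hanti⟩ := F.exists_antilipschitzWith hker
  have hC' : (0 : ℝ) < C := hC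
  have hcard : (0 : ℝ) < Fintype.card T := by exact_mod_cast Fintype.card_pos
  refine ⟨1 / (4 * Fintype.card T * C ^ 2), by positivity, fun v => ?_⟩
  have hv : ‖v‖ ≤ C * ‖F v‖ := by simpa using hanti.le_mul_dist v 0
  have hsum : ∑ t, v t ^ 2 ≤ Fintype.card T * ‖v‖ ^ 2 := by
    rw [← nsmul_eq_mul]
    refine Finset.sum_le_card_nsmul _ _ _ fun t _ => ?_
    rw [← sq_abs]
    exact pow_le_pow_left₀ (abs_nonneg _) (norm_le_pi_norm v t) 2
  -- The factor 2 is there because the supremum need not be attained. When it is 0 any y works, and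
  -- S is nonempty because the masses sum to 1.
  obtain ⟨y, hy⟩ : ∃ y, ‖F v‖ ≤ 2 * |mix K v y| := by
    by_contra! h
    rcases eq_or_lt_of_le (norm_nonneg (F v)) with h0 | h0
    · obtain ⟨t⟩ := ‹Nonempty T›
      obtain ⟨y⟩ : Nonempty S := by
        by_contra hS
        rw [not_nonempty_iff] at hS
        simpa using (hK.hasSum t).unique hasSum_empty
      have h1 := h y
      have h2 := abs_nonneg (mix K v y)
      linarith
    · have h1 : ‖F v‖ ≤ ‖F v‖ / 2 :=
        (BoundedContinuousFunction.norm_le (by positivity)).2 fun y => by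
          rw [hF, Real.norm_eq_abs]
          linarith [h y]
      linarith
  refine ⟨y, ?_⟩
  have h1 : ‖v‖ ≤ C * (2 * |mix K v y|) := hv.trans (by gcongr)
  have h2 : ‖v‖ ^ 2 ≤ (C * (2 * |mix K v y|)) ^ 2 := pow_le_pow_left₀ (norm_nonneg _) h1 2
  rw [mul_pow, mul_pow, sq_abs] at h2
  rw [div_mul_eq_mul_div, one_mul, div_le_iff₀ (by positivity)]
  nlinarith

theorem summable_mix_mul_relErr (hK : RegularKernel K ρ) (hw : IsPosPMF w) (hg : IsPosPMF g) :
    Summable fun y => mix K w y * relErr K w g y := by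
  refine Summable.of_norm_bounded (hK.summable_mix_mul_pow w 1) fun y => ?_
  rw [norm_mul, Real.norm_eq_abs, Real.norm_eq_abs, abs_of_pos (hK.mix_pos hw y), pow_one]
  exact mul_le_mul_of_nonneg_left (hK.abs_relErr_le hw hg y) (hK.mix_pos hw y).le

/-- The drift of Newton's algorithm is at least a multiple of the squared distance. -/
theorem exists_le_tsum_relErr (hK : RegularKernel K ρ) (hw : IsPosPMF w) :
    ∃ c > 0, ∀ g, IsPosPMF g →
      c * ∑ t, (w t - g t) ^ 2 ≤ ∑' y, mix K w y * relErr K w g y := by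
  have := hw.nonempty
  obtain ⟨c, hc, h⟩ := hK.exists_le_mix_sq
  refine ⟨c, hc, fun g hg => ?_⟩
  obtain ⟨y, hy⟩ := h fun t => w t - g t
  rw [mix_sub] at hy
  -- Subtracting the zero-sum series of p_w - p_g turns the drift into the χ² series (p_w - p_g)² /
  -- p_g. Its terms are nonnegative, so one well-chosen y is enough, with p_g ≤ 1.
  have hsum := ((hK.summable_mix_mul_relErr hw hg).hasSum).sub
    ((hK.hasSum_mix hw).sub (hK.hasSum_mix hg))
  rw [sub_self, sub_zero] at hsum
  have heq : ∀ y, mix K w y * relErr K w g y - (mix K w y - mix K g y) =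
      (mix K w y - mix K g y) ^ 2 / mix K g y := fun y => by
    have := (hK.mix_pos hg y).ne'
    rw [relErr]
    field_simp
  refine hy.trans (le_trans ?_ (le_hasSum hsum y fun y' _ => ?_))
  · rw [heq]
    exact le_div_self (sq_nonneg _) (hK.mix_pos hg y) (hK.mix_le_one hg y)
  · rw [heq]
    exact div_nonneg (sq_nonneg _) (hK.mix_pos hg y').le

/-! ### One step of Newton's algorithm: pointwise and mean bounds for the Lyapunov function. -/

theorem isPosPMF_newtonStep (hK : RegularKernel K ρ) (hg : IsPosPMF g) {a : ℝ} (ha : 0 < a)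
    (ha1 : a < 1) (y : S) : IsPosPMF (newtonStep K a g y) where
  pos t := by
    have h0 := hK.mix_pos hg y
    have h1 := hg.pos t
    have h2 := hK.pos y t
    have h3 : 0 < 1 - a := by linarith
    unfold newtonStep
    positivity
  sum_eq_one := by
    simp only [newtonStep]
    rw [Finset.sum_add_distrib, ← Finset.mul_sum, ← Finset.mul_sum, ← Finset.sum_div,
      hg.sum_eq_one]
    change (1 - a) * 1 + a * (mix K g y / mix K g y) = 1
    rw [div_self (hK.mix_pos hg y).ne']
    ring

/-- The step multiplies `g` by u = 1 + a (K / p_g - 1) ≥ 1 - a₁, so `inv_affinity_mul_le` applies.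
The first-order part of ∑ w / u is -a times the `w`-average of K / p_g - 1, which is `relErr`. -/
theorem klExcess_newtonStep_le (hK : RegularKernel K ρ) (hw : IsPosPMF w) (hg : IsPosPMF g)
    {a a₁ : ℝ} (ha : 0 < a) (haa : a ≤ a₁) (ha1 : a₁ < 1) (y : S) :
    klExcess w (newtonStep K a g y) ≤ klExcess w g +
      (1 + klExcess w g) * (a * (-relErr K w g y + a * ((1 - a₁)⁻¹ * ρ y ^ 2))) := by
  have h0 := hK.mix_pos hg y
  set u : T → ℝ := fun t => 1 + a * (K y t / mix K g y - 1) with hu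
  have hr : ∀ t, 0 < K y t / mix K g y := fun t => div_pos (hK.pos y t) h0
  have hu1 : ∀ t, 1 - a₁ ≤ u t := fun t => by
    have := mul_pos ha (hr t)
    simp only [hu]
    linarith
  have hb : 0 < 1 - a₁ := by linarith
  have hstep : newtonStep K a g y = fun t => g t * u t := by
    funext t
    simp only [newtonStep, hu]
    ring
  have hinv : ∀ t, (u t)⁻¹ ≤ 1 - a * (K y t / mix K g y - 1) + a ^ 2 * ((1 - a₁)⁻¹ * ρ y ^ 2) := by
    intro t
    have hut : 0 < u t := hb.trans_le (hu1 t)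
    set x := K y t / mix K g y - 1 with hx
    have hx1 : x ^ 2 ≤ ρ y ^ 2 := by
      have h1 : K y t / mix K g y ≤ ρ y := (div_le_iff₀ h0).2 (hK.le_mul_mix hg y t)
      have h2 := hr t
      have h3 := hK.one_le y
      exact sq_le_sq' (by linarith) (by linarith)
    -- Exact second-order expansion of 1 / (1 + a x), the remainder retaining the factor 1 / u.
    have h1 : (u t)⁻¹ = 1 - a * x + a ^ 2 * (x ^ 2 * (u t)⁻¹) := by
      have : u t = 1 + a * x := rfl
      field_simp
      rw [this]
      ring
    have h2 : x ^ 2 * (u t)⁻¹ ≤ (1 - a₁)⁻¹ * ρ y ^ 2 := by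
      rw [mul_comm]
      exact mul_le_mul (inv_anti₀ hb (hu1 t)) hx1 (sq_nonneg _) (inv_pos.2 hb).le
    rw [h1]
    have := mul_le_mul_of_nonneg_left h2 (sq_nonneg a)
    linarith
  have hsum : ∑ t, w t * (u t)⁻¹ ≤
      1 + a * (-relErr K w g y + a * ((1 - a₁)⁻¹ * ρ y ^ 2)) := by
    calc ∑ t, w t * (u t)⁻¹ ≤ ∑ t, w t * (1 - a * (K y t / mix K g y - 1)
          + a ^ 2 * ((1 - a₁)⁻¹ * ρ y ^ 2)) :=
        Finset.sum_le_sum fun t _ => mul_le_mul_of_nonneg_left (hinv t) (hw.pos t).le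
      _ = ∑ t, (w t * (1 + a + a ^ 2 * ((1 - a₁)⁻¹ * ρ y ^ 2))
          - a * (K y t * w t / mix K g y)) := Finset.sum_congr rfl fun t _ => by ring
      _ = 1 + a + a ^ 2 * ((1 - a₁)⁻¹ * ρ y ^ 2) - a * (mix K w y / mix K g y) := by
        rw [Finset.sum_sub_distrib, ← Finset.sum_mul, ← Finset.mul_sum, ← Finset.sum_div,
          hw.sum_eq_one, one_mul]
        rfl
      _ = _ := by rw [relErr]; ring
  have h := inv_affinity_mul_le hw hg fun t => hb.trans_le (hu1 t)
  have h1 := mul_le_mul_of_nonneg_left hsum (inv_pos.2 (affinity_pos hw hg)).le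
  rw [hstep]
  have h2 : (affinity w g)⁻¹ = 1 + klExcess w g := by rw [klExcess]; ring
  rw [h2] at h h1
  rw [klExcess]
  linarith

/-- The pointwise bound behind the moment recursion. -/
theorem exists_klExcess_newtonStep_pow_le (hK : RegularKernel K ρ) (hw : IsPosPMF w) {a₁ : ℝ}
    (ha0 : 0 ≤ a₁) (ha1 : a₁ < 1) (r : ℕ) :
    ∃ C > 0, ∀ g, IsPosPMF g → ∀ a, 0 < a → a ≤ a₁ → ∀ y,
      klExcess w (newtonStep K a g y) ^ (r + 2) ≤ klExcess w g ^ (r + 2)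
        - (r + 2) * klExcess w g ^ (r + 1) * (1 + klExcess w g) * a * relErr K w g y
        + C * (a ^ 2 * (1 + klExcess w g) * (klExcess w g + a) ^ (r + 1)) * ρ y ^ (2 * r + 4) := by
  set β : ℝ := (1 - a₁)⁻¹ with hβ
  have hb : 0 < 1 - a₁ := by linarith
  have hβ1 : 1 ≤ β := (one_le_inv₀ hb).2 (by linarith)
  set N : ℝ := (Fintype.card T : ℝ)
  have hN0 : 0 ≤ N := Nat.cast_nonneg _
  -- The first summand comes from the a² part of h in the linear Taylor term, the second from the
  -- remainder h² (x + |h|) ^ r.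
  refine ⟨(r + 2) * β + (r + 2) ^ 2 * (2 * (2 * (8 * N + β ^ 2)) * (4 * β) ^ r), by positivity,
    fun g hg a ha haa y => ?_⟩
  have hx := klExcess_nonneg hw hg
  have hZs := one_add_klExcess_mul hw hg
  have hs0 : 0 ≤ 1 - affinity w g := sub_nonneg.2 (affinity_le_one hw hg)
  have hL := hK.klExcess_newtonStep_le hw hg ha haa ha1 y
  have hL0 := klExcess_nonneg hw (hK.isPosPMF_newtonStep hg ha (haa.trans_lt ha1) y)
  have hm := hK.abs_relErr_le hw hg y
  have hm2 := hK.relErr_sq_le hw hg y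
  have hR := hK.one_le y
  set x := klExcess w g
  set s := 1 - affinity w g
  set m := relErr K w g y
  set R := ρ y
  set L' := klExcess w (newtonStep K a g y)
  rw [← hβ] at hL
  set h := (1 + x) * (a * (-m + a * (β * R ^ 2))) with hh
  have ha1' : a ≤ 1 := by linarith
  have hR0 : 0 ≤ R := by linarith
  have hβR : R ≤ β * R ^ 2 := by nlinarith
  have habs : |h| ≤ 2 * β * R ^ 2 * ((1 + x) * a) := by
    have h1 : |-m + a * (β * R ^ 2)| ≤ 2 * β * R ^ 2 := by
      rw [abs_le] at hm ⊢
      have : a * (β * R ^ 2) ≤ β * R ^ 2 := mul_le_of_le_one_left (by positivity) ha1'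
      have : 0 ≤ a * (β * R ^ 2) := by positivity
      constructor <;> linarith [hm.1, hm.2]
    rw [hh, abs_mul, abs_mul, abs_of_pos ha, abs_of_nonneg (by positivity : 0 ≤ 1 + x)]
    calc (1 + x) * (a * |-m + a * (β * R ^ 2)|) ≤ (1 + x) * (a * (2 * β * R ^ 2)) := by gcongr
      _ = _ := by ring
  have hxh : x + |h| ≤ 4 * β * R ^ 2 * (x + a) := by
    have h1 : 1 ≤ β * R ^ 2 := by nlinarith
    have h2 : (1 + x) * a ≤ x + a := by nlinarith
    nlinarith [mul_nonneg (by positivity : 0 ≤ β * R ^ 2) (sub_nonneg.2 h2),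
      mul_nonneg (by linarith : 0 ≤ β * R ^ 2 - 1) hx,
      mul_nonneg (by positivity : 0 ≤ β * R ^ 2) ha.le]
  have hsq : h ^ 2 ≤ 2 * (2 * (8 * N + β ^ 2)) * (a ^ 2 * (1 + x) * (x + a)) * R ^ 4 := by
    have h1 : (-m + a * (β * R ^ 2)) ^ 2 ≤ 2 * (8 * N + β ^ 2) * R ^ 4 * (s + a ^ 2) := by
      have hR24 : R ^ 2 ≤ R ^ 4 := pow_le_pow_right₀ hR (by norm_num)
      have h2 : (-m + a * (β * R ^ 2)) ^ 2 ≤ 2 * m ^ 2 + 2 * (a ^ 2 * β ^ 2 * R ^ 4) := by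
        nlinarith [sq_nonneg (m + a * (β * R ^ 2))]
      have h3 : 8 * N * R ^ 2 * s ≤ 8 * N * R ^ 4 * s := by gcongr
      have h4 : 0 ≤ β ^ 2 * R ^ 4 * s := by positivity
      have h5 : 0 ≤ 8 * N * R ^ 4 * a ^ 2 := by positivity
      nlinarith
    -- One factor 1 + x is spent on (1 + x) s = x; this keeps h² linear in 1 + x and gives it the
    -- small factor x + a.
    have h6 : (1 + x) ^ 2 * (s + a ^ 2) ≤ 2 * ((1 + x) * (x + a)) := by
      have h7 : (1 + x) * (s + a ^ 2) = x + a ^ 2 * (1 + x) := by rw [mul_add, hZs]; ring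
      have h8 : a ^ 2 * (1 + x) ≤ a + x := by
        have h9 : a ^ 2 ≤ a := by nlinarith
        have h10 : a ^ 2 * x ≤ x := mul_le_of_le_one_left hx (h9.trans ha1')
        linarith
      calc (1 + x) ^ 2 * (s + a ^ 2) = (1 + x) * ((1 + x) * (s + a ^ 2)) := by ring
        _ ≤ (1 + x) * (2 * (x + a)) := by
          rw [h7]
          exact mul_le_mul_of_nonneg_left (by linarith) (by positivity)
        _ = _ := by ring
    calc h ^ 2 = (1 + x) ^ 2 * a ^ 2 * (-m + a * (β * R ^ 2)) ^ 2 := by rw [hh]; ring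
      _ ≤ (1 + x) ^ 2 * a ^ 2 * (2 * (8 * N + β ^ 2) * R ^ 4 * (s + a ^ 2)) := by gcongr
      _ = 2 * (8 * N + β ^ 2) * R ^ 4 * a ^ 2 * ((1 + x) ^ 2 * (s + a ^ 2)) := by ring
      _ ≤ 2 * (8 * N + β ^ 2) * R ^ 4 * a ^ 2 * (2 * ((1 + x) * (x + a))) := by gcongr
      _ = _ := by ring
  have hrem : h ^ 2 * (x + |h|) ^ r ≤ 2 * (2 * (8 * N + β ^ 2)) * (4 * β) ^ r *
      (a ^ 2 * (1 + x) * (x + a) ^ (r + 1)) * R ^ (2 * r + 4) := by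
    calc h ^ 2 * (x + |h|) ^ r ≤ 2 * (2 * (8 * N + β ^ 2)) * (a ^ 2 * (1 + x) * (x + a)) * R ^ 4
          * (4 * β * R ^ 2 * (x + a)) ^ r := by gcongr
      _ = _ := by rw [mul_pow, mul_pow (4 * β)]; ring
  have hlin : (r + 2) * x ^ (r + 1) * h ≤ -((r + 2) * x ^ (r + 1) * (1 + x) * a * m)
      + (r + 2) * β * (a ^ 2 * (1 + x) * (x + a) ^ (r + 1)) * R ^ (2 * r + 4) := by
    have h1 : x ^ (r + 1) ≤ (x + a) ^ (r + 1) := by gcongr; linarith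
    have h2 : R ^ 2 ≤ R ^ (2 * r + 4) := pow_le_pow_right₀ hR (by omega)
    calc (r + 2) * x ^ (r + 1) * h = -((r + 2) * x ^ (r + 1) * (1 + x) * a * m)
          + (r + 2) * β * (a ^ 2 * (1 + x) * x ^ (r + 1)) * R ^ 2 := by rw [hh]; ring
      _ ≤ _ := by gcongr
  calc L' ^ (r + 2) ≤ (x + h) ^ (r + 2) := pow_le_pow_left₀ hL0 hL _
    _ ≤ _ := add_pow_le_taylor hx (hL0.trans hL) r
    _ ≤ x ^ (r + 2) + (-((r + 2) * x ^ (r + 1) * (1 + x) * a * m)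
      + (r + 2) * β * (a ^ 2 * (1 + x) * (x + a) ^ (r + 1)) * R ^ (2 * r + 4))
      + (r + 2) ^ 2 * (2 * (2 * (8 * N + β ^ 2)) * (4 * β) ^ r *
      (a ^ 2 * (1 + x) * (x + a) ^ (r + 1)) * R ^ (2 * r + 4)) := by gcongr
    _ = _ := by ring

/-- The one-step moment recursion of Newton's algorithm. -/
theorem exists_tsum_newtonStep_le (hK : RegularKernel K ρ) (hw : IsPosPMF w) {a₁ : ℝ}
    (ha0 : 0 ≤ a₁) (ha1 : a₁ < 1) (r : ℕ) :
    ∃ c > 0, ∃ C > 0, ∀ g, IsPosPMF g → ∀ a, 0 < a → a ≤ a₁ →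
      (Summable fun y => mix K w y * klExcess w (newtonStep K a g y) ^ (r + 2)) ∧
      ∑' y, mix K w y * klExcess w (newtonStep K a g y) ^ (r + 2) ≤
        (1 - c * a) * klExcess w g ^ (r + 2) +
          C * (a ^ 2 * (1 + klExcess w g) * (klExcess w g + a) ^ (r + 1)) := by
  obtain ⟨C₀, hC₀, hpt⟩ := hK.exists_klExcess_newtonStep_pow_le hw ha0 ha1 r
  obtain ⟨c₁, hc₁, hdrift⟩ := hK.exists_le_tsum_relErr hw
  obtain ⟨C₂, hC₂, hcontr⟩ := exists_one_sub_affinity_le hw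
  set M := ∑' y, mix K w y * ρ y ^ (2 * r + 4) with hM
  have hMs := hK.summable_mix_mul_pow w (2 * r + 4)
  have hM0 : 0 ≤ M := tsum_nonneg fun y =>
    mul_nonneg (hK.mix_pos hw y).le (pow_nonneg (zero_le_one.trans (hK.one_le y)) _)
  refine ⟨(r + 2) * (c₁ / C₂), by positivity, C₀ * (M + 1), by positivity,
    fun g hg a ha haa => ?_⟩
  have hx := klExcess_nonneg hw hg
  have hZs := one_add_klExcess_mul hw hg
  have hdr := hdrift g hg
  have hco := hcontr g hg
  have hpt' := hpt g hg a ha haa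
  set x := klExcess w g
  set D := ∑' y, mix K w y * relErr K w g y with hD
  set A := (r + 2) * x ^ (r + 1) * (1 + x) * a with hA
  set B := C₀ * (a ^ 2 * (1 + x) * (x + a) ^ (r + 1)) with hB
  have hsum : HasSum (fun y => mix K w y * x ^ (r + 2) - A * (mix K w y * relErr K w g y)
      + B * (mix K w y * ρ y ^ (2 * r + 4))) (1 * x ^ (r + 2) - A * D + B * M) :=
    (((hK.hasSum_mix hw).mul_right _).sub
      ((hK.summable_mix_mul_relErr hw hg).hasSum.mul_left A)).add (hMs.hasSum.mul_left B)
  have hle : ∀ y, mix K w y * klExcess w (newtonStep K a g y) ^ (r + 2) ≤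
      mix K w y * x ^ (r + 2) - A * (mix K w y * relErr K w g y)
      + B * (mix K w y * ρ y ^ (2 * r + 4)) := fun y => by
    have := mul_le_mul_of_nonneg_left (hpt' y) (hK.mix_pos hw y).le
    linarith
  have hnn : ∀ y, 0 ≤ mix K w y * klExcess w (newtonStep K a g y) ^ (r + 2) := fun y =>
    mul_nonneg (hK.mix_pos hw y).le <| pow_nonneg
      (klExcess_nonneg hw (hK.isPosPMF_newtonStep hg ha (haa.trans_lt ha1) y)) _
  have hS := Summable.of_nonneg_of_le hnn hle hsum.summable
  refine ⟨hS, (hasSum_le hle hS.hasSum hsum).trans ?_⟩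
  -- The drift D dominates |w - g|², which dominates 1 - affinity; multiplying by 1 + x gives a
  -- multiple of x.
  have hxD : c₁ / C₂ * x ≤ (1 + x) * D := by
    have h1 : c₁ / C₂ * (1 - affinity w g) ≤ D := by
      refine le_trans ?_ hdr
      rw [div_mul_eq_mul_div, div_le_iff₀ hC₂]
      nlinarith
    calc c₁ / C₂ * x = c₁ / C₂ * ((1 + x) * (1 - affinity w g)) := by rw [hZs]
      _ = (1 + x) * (c₁ / C₂ * (1 - affinity w g)) := by ring
      _ ≤ _ := by gcongr
  have h1 : (r + 2) * (c₁ / C₂) * a * x ^ (r + 2) ≤ A * D := by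
    calc (r + 2) * (c₁ / C₂) * a * x ^ (r + 2) = (r + 2) * a * x ^ (r + 1) * (c₁ / C₂ * x) := by
          ring
      _ ≤ (r + 2) * a * x ^ (r + 1) * ((1 + x) * D) := by gcongr
      _ = _ := by rw [hA]; ring
  have h2 : 0 ≤ B := by positivity
  have h3 : C₀ * (M + 1) * (a ^ 2 * (1 + x) * (x + a) ^ (r + 1)) = B * M + B := by rw [hB]; ring
  rw [h3]
  linarith

end RegularKernel

end Kernel

/-! ### Moments along Newton's algorithm -/

/-- If a nonnegative sequence contracts at rate `c * a n`, up to an error `C * a n ^ (q + 1)`, and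
`a` varies slowly, then the sequence is `O(a n ^ q)`. -/
theorem exists_eventually_le_mul_pow {e a : ℕ → ℝ} {c C : ℝ} (hc : 0 < c) (q : ℕ)
    (ha : ∀ n, 0 < a n) (hsmall : ∀ᶠ n in atTop, c * a (n + 1) ≤ 1)
    (hratio : ∀ᶠ n in atTop, a n ^ q ≤ a (n + 1) ^ q * (1 + c / 2 * a (n + 1)))
    (hrec : ∀ᶠ n in atTop, e (n + 1) ≤ (1 - c * a (n + 1)) * e n + C * a (n + 1) ^ (q + 1)) :
    ∃ M, ∀ᶠ n in atTop, e n ≤ M * a n ^ q := by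
  obtain ⟨N, hN⟩ := eventually_atTop.1 (hsmall.and (hratio.and hrec))
  -- M ≥ 2 C / c lets half of the contraction pay for the error term, the other half paying for the
  -- variation of a; the last entry starts the induction at N.
  set M := max (max (2 * C / c) 0) (e N / a N ^ q) with hM
  have hM1 : C ≤ M * c / 2 := by
    have : 2 * C / c ≤ M := (le_max_left _ _).trans (le_max_left _ _)
    rw [div_le_iff₀ hc] at this
    linarith
  have hM0 : 0 ≤ M := (le_max_right _ _).trans (le_max_left _ _)
  refine ⟨M, eventually_atTop.2 ⟨N, fun n hn => ?_⟩⟩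
  induction n, hn using Nat.le_induction with
  | base => exact (div_le_iff₀ (pow_pos (ha N) q)).1 (le_max_right _ _)
  | succ n hn ih =>
    obtain ⟨h1, h2, h3⟩ := hN n hn
    set b := a (n + 1) with hb
    have hb0 : 0 < b := ha _
    have h4 : (1 - c * b) * e n ≤ (1 - c * b) * (M * (b ^ q * (1 + c / 2 * b))) :=
      mul_le_mul_of_nonneg_left (ih.trans (mul_le_mul_of_nonneg_left h2 hM0)) (by linarith)
    have h5 : C * b ^ (q + 1) ≤ M * c / 2 * b ^ (q + 1) := by gcongr
    have h6 : 0 ≤ M * b ^ q * (c ^ 2 * b ^ 2) := by positivity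
    calc e (n + 1) ≤ (1 - c * b) * (M * (b ^ q * (1 + c / 2 * b))) + M * c / 2 * b ^ (q + 1) := by
          linarith
      _ = M * b ^ q - M * b ^ q * (c ^ 2 * b ^ 2) / 2 := by ring
      _ ≤ _ := by linarith

/-! ### The learning rates. -/

section Rate

variable {α γ : ℝ}

theorem rate_pos (hα : 0 < α) (n : ℕ) : 0 < (α + n) ^ (-γ) :=
  Real.rpow_pos_of_pos (by positivity) _

theorem rate_succ_le (hα : 0 < α) (hγ : 0 < γ) (n : ℕ) :
    (α + (n + 1 : ℕ)) ^ (-γ) ≤ (α + 1) ^ (-γ) := by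
  refine Real.rpow_le_rpow_of_nonpos (by positivity) ?_ (by linarith)
  push_cast
  linarith [n.cast_nonneg (α := ℝ)]

theorem rate_one_lt_one (hα : 0 < α) (hγ : 0 < γ) : (α + 1) ^ (-γ) < 1 :=
  Real.rpow_lt_one_of_one_lt_of_neg (by linarith) (by linarith)

theorem tendsto_rate (hγ : 0 < γ) : Tendsto (fun n : ℕ => (α + (n : ℝ)) ^ (-γ)) atTop (𝓝 0) :=
  (tendsto_rpow_neg_atTop hγ).comp
    (tendsto_atTop_add_const_left _ _ tendsto_natCast_atTop_atTop)

/-- The learning rates `(α + n) ^ (-γ)` vary slowly, relative to their size. -/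
theorem eventually_rate_pow_le (hα : 0 < α) (hγ0 : 0 < γ) (hγ1 : γ < 1) {c : ℝ} (hc : 0 < c)
    (q : ℕ) : ∀ᶠ n : ℕ in atTop, ((α + n) ^ (-γ)) ^ q ≤
      ((α + (n + 1 : ℕ)) ^ (-γ)) ^ q * (1 + c * (α + (n + 1 : ℕ)) ^ (-γ)) := by
  -- With z = α + n, consecutive rates have ratio at most 1 + 1 / z, and 1 / z is negligible against
  -- (z + 1) ^ (-γ) because γ < 1. This threshold yields 2 q / z ≤ c (z + 1) ^ (-γ).
  have h1 : ∀ᶠ n : ℕ in atTop, 4 * q / c ≤ (α + (n + 1 : ℕ)) ^ (1 - γ) :=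
    (((tendsto_rpow_atTop (by linarith : 0 < 1 - γ)).comp
      (tendsto_atTop_add_const_left _ α tendsto_natCast_atTop_atTop)).comp
      (tendsto_add_atTop_nat 1)).eventually_ge_atTop _
  have h2 : ∀ᶠ n : ℕ in atTop, (q : ℝ) + 1 ≤ n := tendsto_natCast_atTop_atTop.eventually_ge_atTop _
  filter_upwards [h1, h2] with n hn1 hn2
  have hq : (0 : ℝ) ≤ q := q.cast_nonneg
  set z : ℝ := α + n with hz
  have hz1 : (q : ℝ) + 1 ≤ z := by linarith
  have hz0 : 0 < z := by linarith
  have hz' : α + ((n + 1 : ℕ) : ℝ) = z + 1 := by push_cast; ring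
  rw [hz'] at hn1 ⊢
  have h3 : z ^ (-γ) ≤ (z + 1) ^ (-γ) * (1 + 1 / z) := by
    have h4 : z ^ (-γ) = (z + 1) ^ (-γ) * (1 + 1 / z) ^ γ := by
      have h5 : 1 + 1 / z = (z + 1) / z := by field_simp
      rw [h5, Real.div_rpow (by positivity) hz0.le, Real.rpow_neg hz0.le,
        Real.rpow_neg (by positivity : 0 ≤ z + 1)]
      have := Real.rpow_pos_of_pos hz0 γ
      have := Real.rpow_pos_of_pos (by linarith : 0 < z + 1) γ
      field_simp
    rw [h4]
    have h6 : (1 : ℝ) ≤ 1 + 1 / z := by linarith [one_div_pos.2 hz0]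
    have h7 : (1 + 1 / z) ^ γ ≤ 1 + 1 / z := by
      simpa using Real.rpow_le_rpow_of_exponent_le h6 hγ1.le
    gcongr
  have h8 : (1 + 1 / z) ^ q ≤ 1 + 2 * (q / z) := by
    have h9 : (q : ℝ) / z ≤ 1 := (div_le_one hz0).2 (by linarith)
    have h9' : 0 ≤ (q : ℝ) / z := by positivity
    have h10 : (1 + 1 / z) ^ q ≤ Real.exp (q / z) := by
      calc (1 + 1 / z) ^ q ≤ Real.exp (1 / z) ^ q := by
            refine pow_le_pow_left₀ (by positivity) ?_ _
            linarith [Real.add_one_le_exp (1 / z)]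
        _ = _ := by rw [← Real.exp_nat_mul]; ring_nf
    have h11 := Real.abs_exp_sub_one_le (by rwa [abs_of_nonneg h9'] : |(q : ℝ) / z| ≤ 1)
    rw [abs_of_nonneg h9'] at h11
    linarith [le_abs_self (Real.exp (q / z) - 1)]
  have h12 : 2 * (q / z) ≤ c * (z + 1) ^ (-γ) := by
    have h13 : (z + 1) ^ (1 - γ) = (z + 1) * (z + 1) ^ (-γ) := by
      rw [sub_eq_add_neg, Real.rpow_add (by positivity), Real.rpow_one]
    rw [h13, div_le_iff₀ hc] at hn1
    have h14 : 0 < (z + 1) ^ (-γ) := Real.rpow_pos_of_pos (by linarith) _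
    rw [← mul_div_assoc, div_le_iff₀ hz0]
    have h15 : (z + 1) * (z + 1) ^ (-γ) * c ≤ 2 * z * (z + 1) ^ (-γ) * c := by
      gcongr
      linarith
    linarith
  calc (z ^ (-γ)) ^ q ≤ ((z + 1) ^ (-γ) * (1 + 1 / z)) ^ q :=
        pow_le_pow_left₀ (Real.rpow_pos_of_pos hz0 _).le h3 q
    _ = ((z + 1) ^ (-γ)) ^ q * (1 + 1 / z) ^ q := mul_pow _ _ _
    _ ≤ _ := by
        have : 0 < (z + 1) ^ (-γ) := Real.rpow_pos_of_pos (by linarith) _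
        gcongr
        linarith

end Rate

/-- The sequence of weights produced by Newton's algorithm. -/
def newtonSeq {S T : Type*} [Fintype T] (K : S → T → ℝ) (a : ℕ → ℝ) (g₀ : T → ℝ) (Y : ℕ → S) :
    ℕ → T → ℝ
  | 0 => g₀
  | n + 1 => newtonStep K (a (n + 1)) (newtonSeq K a g₀ Y n) (Y n)

theorem newtonSeq_congr {S T : Type*} [Fintype T] (K : S → T → ℝ) (a : ℕ → ℝ) (g₀ : T → ℝ)
    {Y Y' : ℕ → S} (n : ℕ) (h : ∀ i < n, Y i = Y' i) :
    newtonSeq K a g₀ Y n = newtonSeq K a g₀ Y' n := by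
  induction n with
  | zero => rfl
  | succ n ih => rw [newtonSeq, newtonSeq, ih fun i hi => h i (hi.trans n.lt_succ_self),
      h n n.lt_succ_self]

/-- The expectation of a function of two independent discrete variables. -/
theorem lintegral_eq_lintegral_tsum_of_indepFun {Ω A B : Type*} [MeasurableSpace Ω]
    [MeasurableSpace A] [MeasurableSpace B] [Countable A] [Countable B]
    [MeasurableSingletonClass A] [MeasurableSingletonClass B] {P : Measure Ω}
    [IsProbabilityMeasure P] {X : Ω → A} {Y : Ω → B} (hX : Measurable X) (hY : Measurable Y)
    (h : IndepFun X Y P) (f : A → B → ENNReal) :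
    ∫⁻ ω, f (X ω) (Y ω) ∂P = ∫⁻ ω, ∑' y, P (Y ⁻¹' {y}) * f (X ω) y ∂P := by
  have hf : Measurable fun z : A × B => f z.1 z.2 := measurable_of_countable _
  have := Measure.isProbabilityMeasure_map (μ := P) hY.aemeasurable
  rw [← lintegral_map (f := fun z : A × B => f z.1 z.2) (g := fun ω => (X ω, Y ω)) hf
      (hX.prodMk hY),
    (indepFun_iff_map_prod_eq_prod_map_map hX.aemeasurable hY.aemeasurable).1 h,
    lintegral_prod _ hf.aemeasurable, lintegral_map (measurable_of_countable _) hX]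
  refine lintegral_congr fun ω => ?_
  rw [lintegral_countable']
  refine tsum_congr fun y => ?_
  rw [Measure.map_apply hY (measurableSet_singleton y), mul_comm]

section Newton

variable {S T : Type*} [Fintype T] {K : S → T → ℝ} {ρ : S → ℝ} {w g₀ : T → ℝ}

namespace RegularKernel

theorem isPosPMF_newtonSeq (hK : RegularKernel K ρ) (hg₀ : IsPosPMF g₀) {a : ℕ → ℝ}
    (ha : ∀ n, 0 < a (n + 1)) (ha1 : ∀ n, a (n + 1) < 1) (Y : ℕ → S) (n : ℕ) :
    IsPosPMF (newtonSeq K a g₀ Y n) := by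
  induction n with
  | zero => exact hg₀
  | succ n ih => exact hK.isPosPMF_newtonStep ih (ha n) (ha1 n) _

/-- The one-step moment recursion, with the noise absorbed in the contraction. -/
theorem exists_tsum_newtonStep_le_contraction (hK : RegularKernel K ρ) (hw : IsPosPMF w) {a₁ : ℝ}
    (ha0 : 0 ≤ a₁) (ha1 : a₁ < 1) (r : ℕ) :
    ∃ c > 0, ∃ C > 0, ∃ a₀ > 0, ∀ g, IsPosPMF g → ∀ a, 0 < a → a ≤ a₁ →
      (Summable fun y => mix K w y * klExcess w (newtonStep K a g y) ^ (r + 2)) ∧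
      ∑' y, mix K w y * klExcess w (newtonStep K a g y) ^ (r + 2) ≤
        C * klExcess w g ^ (r + 2) + C ∧
      (a ≤ a₀ → ∑' y, mix K w y * klExcess w (newtonStep K a g y) ^ (r + 2) ≤
        (1 - c * a) * klExcess w g ^ (r + 2) + C * a ^ (r + 3)) := by
  obtain ⟨c, hc, C, hC, h⟩ := hK.exists_tsum_newtonStep_le hw ha0 ha1 r
  obtain ⟨a₀, ha₀, C', hC', h'⟩ := exists_absorb (half_pos hc) hC r
  -- The maximum serves both bounds: the crude affine one, valid for every a ≤ a₁ and used only for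
  -- finiteness of moments, and the contraction, valid for a ≤ a₀.
  refine ⟨c / 2, half_pos hc, max (1 + C * 2 ^ (r + 2)) C', by positivity, a₀, ha₀,
    fun g hg a ha haa => ?_⟩
  obtain ⟨hs, hle⟩ := h g hg a ha haa
  have hx := klExcess_nonneg hw hg
  set x := klExcess w g
  refine ⟨hs, hle.trans ?_, fun haa₀ => hle.trans ?_⟩
  · have h0 : (x + a) ^ (r + 1) ≤ (1 + x) ^ (r + 1) :=
      pow_le_pow_left₀ (by positivity) (by linarith) _
    have h1 : a ^ 2 * (1 + x) * (x + a) ^ (r + 1) ≤ 2 ^ (r + 2) * (x ^ (r + 2) + 1) := by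
      calc a ^ 2 * (1 + x) * (x + a) ^ (r + 1) ≤ 1 * (1 + x) * (1 + x) ^ (r + 1) := by
            gcongr
            exact pow_le_one₀ ha.le (by linarith)
        _ = (x + 1) ^ (r + 2) := by ring
        _ ≤ 2 ^ (r + 2 - 1) * (x ^ (r + 2) + 1 ^ (r + 2)) := add_pow_le hx zero_le_one _
        _ ≤ 2 ^ (r + 2) * (x ^ (r + 2) + 1) := by
            rw [one_pow]
            gcongr
            · norm_num
            · omega
    have h2 : 0 ≤ x ^ (r + 2) := by positivity
    have h3 : 0 ≤ c * a * x ^ (r + 2) := by positivity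
    have h4 : (1 + C * 2 ^ (r + 2)) * (x ^ (r + 2) + 1) ≤
      max (1 + C * 2 ^ (r + 2)) C' * (x ^ (r + 2) + 1) := by gcongr; exact le_max_left _ _
    have h5 := mul_le_mul_of_nonneg_left h1 hC.le
    linarith
  · have h1 := h' x a hx ha haa₀
    have h2 : C' * a ^ (r + 3) ≤ max (1 + C * 2 ^ (r + 2)) C' * a ^ (r + 3) := by
      gcongr; exact le_max_right _ _
    linarith

end RegularKernel

end Newton

/-- Newton's algorithm at time `n` is a function of the first `n` observations. -/
theorem exists_newtonSeq_eq_comp {Ω S T : Type*} [Fintype T] [Nonempty S] (K : S → T → ℝ) (a : ℕ → ℝ) (g₀ : T → ℝ)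
    (Y : ℕ → Ω → S) (n : ℕ) :
    ∃ Φ : (Finset.range n → S) → T → ℝ,
      ∀ ω, newtonSeq K a g₀ (fun i => Y i ω) n = Φ fun i => Y i ω := by
  classical
  -- The arbitrary value at indices outside `Finset.range n` is never read in the first n steps.
  refine ⟨fun x => newtonSeq K a g₀
    (fun i => if h : i ∈ Finset.range n then x ⟨i, h⟩ else Classical.arbitrary S) n, fun ω => ?_⟩
  refine newtonSeq_congr K a g₀ n fun i hi => ?_
  rw [dif_pos (Finset.mem_range.2 hi)]

/-! ### Moments and almost sure convergence with independent observations. -/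

section Random

variable {S T : Type*} [Fintype T] {K : S → T → ℝ} {ρ : S → ℝ} {w g₀ : T → ℝ}
  [MeasurableSpace S] [Countable S] [MeasurableSingletonClass S]
  {Ω : Type*} [MeasurableSpace Ω] {P : Measure Ω} {Y : ℕ → Ω → S}

theorem measurable_comp_newtonSeq [Nonempty S] (hY : ∀ n, Measurable (Y n)) (a : ℕ → ℝ)
    (f : (T → ℝ) → ENNReal) (n : ℕ) :
    Measurable fun ω => f (newtonSeq K a g₀ (fun i => Y i ω) n) := by
  obtain ⟨Φ, hΦ⟩ := exists_newtonSeq_eq_comp K a g₀ Y n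
  simp_rw [hΦ]
  exact (measurable_of_countable fun x => f (Φ x)).comp (measurable_pi_lambda _ fun i => hY i)

/-- One step of the algorithm, in expectation. -/
theorem lintegral_newtonSeq_succ [Nonempty S] [IsProbabilityMeasure P]
    (hY : ∀ n, Measurable (Y n)) (hind : iIndepFun Y P) {p : S → ℝ} (hp : ∀ y, 0 ≤ p y)
    (hlaw : ∀ n y, P (Y n ⁻¹' {y}) = ENNReal.ofReal (p y)) (a : ℕ → ℝ)
    {F : (T → ℝ) → ℝ} (n : ℕ) (hF : ∀ ω y, 0 ≤
      F (newtonStep K (a (n + 1)) (newtonSeq K a g₀ (fun i => Y i ω) n) y))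
    (hs : ∀ ω, Summable fun y =>
      p y * F (newtonStep K (a (n + 1)) (newtonSeq K a g₀ (fun i => Y i ω) n) y)) :
    ∫⁻ ω, ENNReal.ofReal (F (newtonSeq K a g₀ (fun i => Y i ω) (n + 1))) ∂P =
      ∫⁻ ω, ENNReal.ofReal (∑' y,
        p y * F (newtonStep K (a (n + 1)) (newtonSeq K a g₀ (fun i => Y i ω) n) y)) ∂P := by
  obtain ⟨Φ, hΦ⟩ := exists_newtonSeq_eq_comp K a g₀ Y n
  have hind' : IndepFun (fun ω (i : Finset.range n) => Y i ω) (Y n) P :=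
    (hind.indepFun_finset (Finset.range n) {n} (by simp) hY).comp measurable_id
      (measurable_pi_apply (⟨n, Finset.mem_singleton_self n⟩ : ({n} : Finset ℕ)))
  have h := lintegral_eq_lintegral_tsum_of_indepFun
    (measurable_pi_lambda _ fun i : Finset.range n => hY i) (hY n) hind'
    fun x y => ENNReal.ofReal (F (newtonStep K (a (n + 1)) (Φ x) y))
  simp only [newtonSeq, hΦ] at hF hs ⊢
  rw [h]
  refine lintegral_congr fun ω => ?_
  rw [ENNReal.ofReal_tsum_of_nonneg (fun y => mul_nonneg (hp y) (hF ω y)) (hs ω)]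
  refine tsum_congr fun y => ?_
  rw [hlaw, ENNReal.ofReal_mul (hp y)]

namespace RegularKernel

variable {α γ : ℝ}

/-- The moments of the Lyapunov function decay at the rate of the powers of the learning rate. -/
theorem exists_lintegral_klExcess_pow_le (hK : RegularKernel K ρ) (hw : IsPosPMF w)
    (hg₀ : IsPosPMF g₀) [IsProbabilityMeasure P] (hY : ∀ n, Measurable (Y n))
    (hind : iIndepFun Y P) (hlaw : ∀ n y, P (Y n ⁻¹' {y}) = ENNReal.ofReal (mix K w y))
    (hα : 0 < α) (hγ0 : 0 < γ) (hγ1 : γ < 1) (r : ℕ) :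
    (∀ n, ∫⁻ ω, ENNReal.ofReal (klExcess w (newtonSeq K (fun m : ℕ => (α + m) ^ (-γ)) g₀
        (fun i => Y i ω) n) ^ (r + 2)) ∂P ≠ ⊤) ∧
    ∃ M : ℝ, ∀ᶠ n : ℕ in atTop,
      (∫⁻ ω, ENNReal.ofReal (klExcess w (newtonSeq K (fun m : ℕ => (α + m) ^ (-γ)) g₀
        (fun i => Y i ω) n) ^ (r + 2)) ∂P).toReal ≤ M * ((α + n) ^ (-γ)) ^ (r + 2) := by
  have hP : Nonempty Ω := nonempty_of_isProbabilityMeasure P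
  have hS : Nonempty S := hP.map (Y 0)
  set a : ℕ → ℝ := fun m => (α + m) ^ (-γ) with ha
  have hapos : ∀ n, 0 < a n := fun n => rate_pos hα n
  have hale : ∀ n, a (n + 1) ≤ (α + 1) ^ (-γ) := fun n => rate_succ_le hα hγ0 n
  have ha1 := rate_one_lt_one hα hγ0
  have ha0 : (0 : ℝ) ≤ (α + 1) ^ (-γ) := by positivity
  obtain ⟨c, hc, C, hC, a₀, ha₀, hstep⟩ := hK.exists_tsum_newtonStep_le_contraction hw ha0 ha1 r
  have hpmf : ∀ ω n, IsPosPMF (newtonSeq K a g₀ (fun i => Y i ω) n) := fun ω n =>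
    hK.isPosPMF_newtonSeq hg₀ (fun n => hapos _) (fun n => (hale n).trans_lt ha1) _ n
  set E : ℕ → ENNReal := fun n => ∫⁻ ω, ENNReal.ofReal
    (klExcess w (newtonSeq K a g₀ (fun i => Y i ω) n) ^ (r + 2)) ∂P with hE
  have hsucc : ∀ n, E (n + 1) = ∫⁻ ω, ENNReal.ofReal (∑' y, mix K w y *
      klExcess w (newtonStep K (a (n + 1)) (newtonSeq K a g₀ (fun i => Y i ω) n) y) ^ (r + 2)) ∂P :=
    fun n => lintegral_newtonSeq_succ hY hind (fun y => (hK.mix_pos hw y).le) hlaw a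
      (F := fun g => klExcess w g ^ (r + 2)) n
      (fun ω y => pow_nonneg (klExcess_nonneg hw (hK.isPosPMF_newtonStep (hpmf ω n) (hapos _)
        ((hale n).trans_lt ha1) y)) _)
      (fun ω => (hstep _ (hpmf ω n) _ (hapos _) (hale n)).1)
  have haffine : ∀ n (b b' : ℝ), 0 ≤ b → (∀ ω, ∑' y, mix K w y *
      klExcess w (newtonStep K (a (n + 1)) (newtonSeq K a g₀ (fun i => Y i ω) n) y) ^ (r + 2) ≤
        b * klExcess w (newtonSeq K a g₀ (fun i => Y i ω) n) ^ (r + 2) + b') →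
      E (n + 1) ≤ ENNReal.ofReal b * E n + ENNReal.ofReal b' := by
    intro n b b' hb h
    calc E (n + 1) ≤ ∫⁻ ω, (ENNReal.ofReal b * ENNReal.ofReal
          (klExcess w (newtonSeq K a g₀ (fun i => Y i ω) n) ^ (r + 2)) + ENNReal.ofReal b') ∂P := by
          rw [hsucc]
          refine lintegral_mono fun ω => ?_
          rw [← ENNReal.ofReal_mul hb]
          exact (ENNReal.ofReal_le_ofReal (h ω)).trans ENNReal.ofReal_add_le
      _ = _ := by
          rw [lintegral_add_right _ measurable_const,
            lintegral_const_mul' _ _ ENNReal.ofReal_ne_top]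
          simp [hE]
  -- Early learning rates may exceed a₀, so finiteness is propagated by the crude affine bound; the
  -- contraction is used only for large n.
  have hfin : ∀ n, E n ≠ ⊤ := by
    intro n
    induction n with
    | zero => simp [hE, newtonSeq]
    | succ n ih =>
      refine ne_top_of_le_ne_top ?_ (haffine n C C hC.le fun ω =>
        (hstep _ (hpmf ω n) _ (hapos _) (hale n)).2.1)
      exact ENNReal.add_ne_top.2 ⟨ENNReal.mul_ne_top ENNReal.ofReal_ne_top ih,
        ENNReal.ofReal_ne_top⟩
  have hlim : Tendsto (fun n => a (n + 1)) atTop (𝓝 0) :=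
    (tendsto_rate hγ0).comp (tendsto_add_atTop_nat 1)
  have hsmall : ∀ᶠ n in atTop, c * a (n + 1) ≤ 1 := by
    have h1 : Tendsto (fun n => c * a (n + 1)) atTop (𝓝 0) := by simpa using hlim.const_mul c
    exact h1.eventually_le_const zero_lt_one
  refine ⟨hfin, exists_eventually_le_mul_pow (C := C) hc (r + 2) hapos hsmall
    (eventually_rate_pow_le hα hγ0 hγ1 (half_pos hc) (r + 2)) ?_⟩
  filter_upwards [hsmall, hlim.eventually_le_const ha₀] with n hn1 hn2
  have hb : 0 ≤ 1 - c * a (n + 1) := by linarith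
  have hb' : 0 ≤ C * a (n + 1) ^ (r + 3) := mul_nonneg hC.le (pow_nonneg (hapos _).le _)
  have h := haffine n _ _ hb fun ω => (hstep _ (hpmf ω n) _ (hapos _) (hale n)).2.2 hn2
  have h' := ENNReal.toReal_mono (ENNReal.add_ne_top.2
    ⟨ENNReal.mul_ne_top ENNReal.ofReal_ne_top (hfin n), ENNReal.ofReal_ne_top⟩) h
  rwa [ENNReal.toReal_add (ENNReal.mul_ne_top ENNReal.ofReal_ne_top (hfin n))
    ENNReal.ofReal_ne_top, ENNReal.toReal_mul, ENNReal.toReal_ofReal hb,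
    ENNReal.toReal_ofReal hb'] at h'

/-- The almost sure rate of convergence of the Lyapunov function along Newton's algorithm. -/
theorem ae_tendsto_rpow_mul_klExcess (hK : RegularKernel K ρ) (hw : IsPosPMF w)
    (hg₀ : IsPosPMF g₀) [IsProbabilityMeasure P] (hY : ∀ n, Measurable (Y n))
    (hind : iIndepFun Y P) (hlaw : ∀ n y, P (Y n ⁻¹' {y}) = ENNReal.ofReal (mix K w y))
    (hα : 0 < α) (hγ0 : 0 < γ) (hγ1 : γ < 1) {δ : ℝ} (hδ : δ < γ) :
    ∀ᵐ ω ∂P, Tendsto (fun n : ℕ => (n : ℝ) ^ δ * klExcess w (newtonSeq K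
      (fun m : ℕ => (α + m) ^ (-γ)) g₀ (fun i => Y i ω) n)) atTop (𝓝 0) := by
  have hP : Nonempty Ω := nonempty_of_isProbabilityMeasure P
  have hS : Nonempty S := hP.map (Y 0)
  -- The moment order r + 2 is taken so large that n ^ (-(γ - δ) (r + 2)) is summable.
  obtain ⟨r, hr⟩ := exists_nat_gt (1 / (γ - δ))
  have hgap : 0 < γ - δ := by linarith
  have hr' : 1 < (γ - δ) * (r + 2 : ℕ) := by
    rw [div_lt_iff₀ hgap] at hr
    push_cast
    linarith
  obtain ⟨hfin, M, hM⟩ := hK.exists_lintegral_klExcess_pow_le hw hg₀ hY hind hlaw hα hγ0 hγ1 r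
  set a : ℕ → ℝ := fun m => (α + m) ^ (-γ) with ha
  have hpmf : ∀ ω n, IsPosPMF (newtonSeq K a g₀ (fun i => Y i ω) n) := fun ω n =>
    hK.isPosPMF_newtonSeq hg₀ (fun n => rate_pos hα _)
      (fun n => (rate_succ_le hα hγ0 n).trans_lt (rate_one_lt_one hα hγ0)) _ n
  have hnn : ∀ ω n, 0 ≤ klExcess w (newtonSeq K a g₀ (fun i => Y i ω) n) := fun ω n =>
    klExcess_nonneg hw (hpmf ω n)
  have hsum : Summable fun n : ℕ => ((n : ℝ) ^ δ) ^ (r + 2) * (∫⁻ ω, ENNReal.ofReal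
      (klExcess w (newtonSeq K a g₀ (fun i => Y i ω) n) ^ (r + 2)) ∂P).toReal := by
    have hs : Summable fun n : ℕ => |M| * (n : ℝ) ^ (-((γ - δ) * (r + 2 : ℕ))) :=
      (Real.summable_nat_rpow.2 (by linarith)).mul_left _
    refine Summable.of_norm_bounded_eventually_nat hs ?_
    filter_upwards [hM, eventually_gt_atTop 0] with n hn hn0
    have hn0' : (0 : ℝ) < n := Nat.cast_pos.2 hn0
    rw [Real.norm_of_nonneg (by positivity)]
    have h1 : ((α + n) ^ (-γ)) ^ (r + 2) ≤ ((n : ℝ) ^ (-γ)) ^ (r + 2) :=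
      pow_le_pow_left₀ (rate_pos hα n).le
        (Real.rpow_le_rpow_of_nonpos hn0' (by linarith) (by linarith)) _
    have h2 : M * ((α + n) ^ (-γ)) ^ (r + 2) ≤ |M| * ((n : ℝ) ^ (-γ)) ^ (r + 2) :=
      mul_le_mul (le_abs_self M) h1 (pow_nonneg (rate_pos hα n).le _) (abs_nonneg M)
    calc ((n : ℝ) ^ δ) ^ (r + 2) * _ ≤ ((n : ℝ) ^ δ) ^ (r + 2) *
          (|M| * ((n : ℝ) ^ (-γ)) ^ (r + 2)) := by gcongr; exact hn.trans h2
      _ = |M| * ((n : ℝ) ^ δ * (n : ℝ) ^ (-γ)) ^ (r + 2) := by ring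
      _ = _ := by
        rw [← Real.rpow_add hn0', ← Real.rpow_mul_natCast hn0'.le]
        congr 2
        ring
  have hmeas : ∀ n : ℕ, Measurable fun ω => ENNReal.ofReal (((n : ℝ) ^ δ *
      klExcess w (newtonSeq K a g₀ (fun i => Y i ω) n)) ^ (r + 2)) := fun n =>
    measurable_comp_newtonSeq hY a
      (fun g => ENNReal.ofReal (((n : ℝ) ^ δ * klExcess w g) ^ (r + 2))) n
  have hint : ∫⁻ ω, ∑' n : ℕ, ENNReal.ofReal (((n : ℝ) ^ δ *
      klExcess w (newtonSeq K a g₀ (fun i => Y i ω) n)) ^ (r + 2)) ∂P ≠ ⊤ := by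
    rw [lintegral_tsum fun n => (hmeas n).aemeasurable]
    have h1 : ∀ n : ℕ, ∫⁻ ω, ENNReal.ofReal (((n : ℝ) ^ δ *
        klExcess w (newtonSeq K a g₀ (fun i => Y i ω) n)) ^ (r + 2)) ∂P =
        ENNReal.ofReal (((n : ℝ) ^ δ) ^ (r + 2) * (∫⁻ ω, ENNReal.ofReal
          (klExcess w (newtonSeq K a g₀ (fun i => Y i ω) n) ^ (r + 2)) ∂P).toReal) := by
      intro n
      have h2 : 0 ≤ ((n : ℝ) ^ δ) ^ (r + 2) := by positivity
      simp_rw [mul_pow, ENNReal.ofReal_mul h2]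
      rw [lintegral_const_mul' _ _ ENNReal.ofReal_ne_top, ENNReal.ofReal_toReal (hfin n)]
    simp_rw [h1]
    exact hsum.tsum_ofReal_ne_top
  -- A series with finite expectation is almost surely finite, so its terms tend to 0; taking the (r
  -- + 2)-th root removes the power.
  filter_upwards [ae_lt_top (Measurable.tsum hmeas) hint] with ω hω
  have h1 := ENNReal.tendsto_atTop_zero_of_tsum_ne_top hω.ne
  have h2 := (ENNReal.tendsto_toReal ENNReal.zero_ne_top).comp h1
  have h3 := h2.rpow_const (p := ((r + 2 : ℕ) : ℝ)⁻¹) (Or.inr (by positivity))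
  rw [ENNReal.toReal_zero, Real.zero_rpow (by positivity)] at h3
  refine h3.congr fun n => ?_
  have h4 : 0 ≤ (n : ℝ) ^ δ * klExcess w (newtonSeq K a g₀ (fun i => Y i ω) n) :=
    mul_nonneg (by positivity) (hnn ω n)
  rw [Function.comp_apply, ENNReal.toReal_ofReal (pow_nonneg h4 _),
    Real.pow_rpow_inv_natCast h4 (by omega)]

end RegularKernel

end Random

/-! ### The Poisson kernel on a product grid -/

/-- Stability of the posterior mean of a bounded function b of the parameter. It is applied with b t
= ϑ (t j), the j-th coordinate. -/
theorem RegularKernel.abs_mix_div_mix_sub_le {S T : Type*} [Fintype T] {K : S → T → ℝ}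
    {ρ : S → ℝ} {w g : T → ℝ} (hK : RegularKernel K ρ) (hw : IsPosPMF w) (hg : IsPosPMF g)
    {b : T → ℝ} {H : ℝ} (hb0 : ∀ t, 0 ≤ b t) (hb : ∀ t, b t ≤ H) (y : S) :
    |mix K (fun t => b t * g t) y / mix K g y - mix K (fun t => b t * w t) y / mix K w y| ≤
      2 * H * (ρ y * ∑ t, |g t - w t|) := by
  have hpg := hK.mix_pos hg y
  have hpw := hK.mix_pos hw y
  obtain ⟨t₀⟩ := hw.nonempty
  have hH : 0 ≤ H := (hb0 t₀).trans (hb t₀)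
  have hρ : 0 ≤ ρ y := zero_le_one.trans (hK.one_le y)
  -- Both terms on the right have denominator p_g and a numerator linear in g - w; the coefficient
  -- of the second is a posterior mean under `w`, hence at most H.
  have heq : mix K (fun t => b t * g t) y / mix K g y - mix K (fun t => b t * w t) y / mix K w y =
      mix K (fun t => b t * (g t - w t)) y / mix K g y -
        mix K (fun t => b t * w t) y / mix K w y *
          (mix K (fun t => g t - w t) y / mix K g y) := by
    simp only [mul_sub]
    rw [mix_sub, mix_sub]
    field_simp
    ring
  have h1 : |mix K (fun t => b t * (g t - w t)) y / mix K g y| ≤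
      H * (ρ y * ∑ t, |g t - w t|) := by
    rw [abs_div, abs_of_pos hpg]
    refine (hK.abs_mix_div_mix_le hg _ y).trans ?_
    rw [mul_left_comm H, Finset.mul_sum _ _ H]
    refine mul_le_mul_of_nonneg_left (Finset.sum_le_sum fun t _ => ?_) hρ
    rw [abs_mul, abs_of_nonneg (hb0 t)]
    exact mul_le_mul_of_nonneg_right (hb t) (abs_nonneg _)
  have h2 : |mix K (fun t => b t * w t) y / mix K w y| ≤ H := by
    have h0 : 0 ≤ mix K (fun t => b t * w t) y := Finset.sum_nonneg fun t _ =>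
      mul_nonneg (hK.pos y t).le (mul_nonneg (hb0 t) (hw.pos t).le)
    rw [abs_of_nonneg (div_nonneg h0 hpw.le), div_le_iff₀ hpw, mix, mix, Finset.mul_sum]
    refine Finset.sum_le_sum fun t _ => ?_
    rw [← mul_assoc, mul_comm (K y t), mul_assoc]
    exact mul_le_mul_of_nonneg_right (hb t) (mul_nonneg (hK.pos y t).le (hw.pos t).le)
  have h3 : |mix K (fun t => g t - w t) y / mix K g y| ≤ ρ y * ∑ t, |g t - w t| := by
    rw [abs_div, abs_of_pos hpg]
    exact hK.abs_mix_div_mix_le hg _ y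
  rw [heq]
  refine (abs_sub _ _).trans ?_
  rw [abs_mul]
  have h4 := mul_le_mul h2 h3 (abs_nonneg _) hH
  linarith

variable {k d : ℕ}

theorem pi_poissonMeasure_singleton (θ : Fin k → ℝ≥0) (y : Fin k → ℕ) :
    Measure.pi (fun j => poissonMeasure (θ j)) {y} = ENNReal.ofReal (kern y θ) := by
  rw [Measure.pi_singleton, kern, ENNReal.ofReal_prod_of_nonneg fun j _ => by positivity]
  exact Finset.prod_congr rfl fun j _ => poissonMeasure_singleton _ _

theorem kern_nonneg (y : Fin k → ℕ) (θ : Fin k → ℝ≥0) : 0 ≤ kern y θ :=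
  Finset.prod_nonneg fun j _ => by positivity

theorem hasSum_kern (θ : Fin k → ℝ≥0) : HasSum (fun y => kern y θ) 1 := by
  have h : ∑' y, ENNReal.ofReal (kern y θ) = 1 := by
    rw [← measure_univ (μ := Measure.pi fun j => poissonMeasure (θ j)), ← lintegral_one,
      lintegral_countable']
    exact tsum_congr fun y => by rw [one_mul, pi_poissonMeasure_singleton]
  have hs : Summable fun y => kern y θ := by
    have := ENNReal.summable_toReal (h.trans_ne ENNReal.one_ne_top)
    exact this.congr fun y => ENNReal.toReal_ofReal (kern_nonneg y θ)
  rw [← ENNReal.ofReal_tsum_of_nonneg (fun y => kern_nonneg y θ) hs, ENNReal.ofReal_eq_one] at h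
  exact h ▸ hs.hasSum

theorem gridPoint_injective {ϑ : Fin d → ℝ≥0} (hϑ : Function.Injective ϑ) :
    Function.Injective (gridPoint ϑ : (Fin k → Fin d) → Fin k → ℝ≥0) := fun _ _ h =>
  funext fun j => hϑ (congrFun h j)

/-- The Poisson probability mass functions with parameters in the grid are linearly
independent. -/
theorem eq_zero_of_mix_kern_eq_zero {ϑ : Fin d → ℝ≥0} (hϑ : Function.Injective ϑ)
    {v : (Fin k → Fin d) → ℝ} (h : ∀ y, mix (fun y (t : Fin k → Fin d) => kern y (gridPoint ϑ t)) v y = 0) :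
    v = 0 := by
  -- Up to the factorials, common to all t, and the exponentials, absorbed in the coefficients, the
  -- kernels are the distinct characters y ↦ ∏ ϑ ^ y of the monoid ℕ ^ k. Dedekind's theorem makes
  -- these independent.
  let f : (Fin k → Fin d) → (Multiplicative (Fin k → ℕ) →* ℝ) := fun t =>
    { toFun := fun y => ∏ j, (ϑ (t j) : ℝ) ^ (Multiplicative.toAdd y) j
      map_one' := by simp
      map_mul' := fun y y' => by simp [pow_add, Finset.prod_mul_distrib] }
  have hf : Function.Injective f := by
    refine fun t t' htt => funext fun j => hϑ (NNReal.coe_injective ?_)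
    have h1 : ∀ s : Fin k → Fin d, f s (Multiplicative.ofAdd (Pi.single j 1)) = ϑ (s j) := by
      intro s
      change ∏ i, (ϑ (s i) : ℝ) ^ (Pi.single j 1 : Fin k → ℕ) i = _
      rw [Finset.prod_eq_single j (fun i _ hi => by simp [hi]) (by simp)]
      simp
    rw [← h1 t, ← h1 t', htt]
  have hli := Fintype.linearIndependent_iff.1
    ((linearIndependent_monoidHom (Multiplicative (Fin k → ℕ)) ℝ).comp f hf)
    (fun t => v t * ∏ j, Real.exp (-(ϑ (t j) : ℝ))) (by
      ext y
      have h1 := h (Multiplicative.toAdd y)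
      have h2 : mix (fun y (t : Fin k → Fin d) => kern y (gridPoint ϑ t)) v (Multiplicative.toAdd y) =
          (∑ t, v t * (∏ j, Real.exp (-(ϑ (t j) : ℝ))) * f t y) /
            ∏ j, ((Multiplicative.toAdd y j).factorial : ℝ) := by
        rw [mix, Finset.sum_div]
        refine Finset.sum_congr rfl fun t _ => ?_
        change (∏ j, Real.exp (-(ϑ (t j) : ℝ)) * (ϑ (t j) : ℝ) ^ _ / _) * v t = _ * (∏ j : Fin k, _) / _
        rw [Finset.prod_div_distrib, Finset.prod_mul_distrib]
        ring
      rw [h2, div_eq_zero_iff] at h1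
      have h3 : ∏ j, ((Multiplicative.toAdd y j).factorial : ℝ) ≠ 0 :=
        Finset.prod_ne_zero_iff.2 fun j _ => by positivity
      simpa using h1.resolve_right h3)
  funext t
  have h1 : ∏ j, Real.exp (-(ϑ (t j) : ℝ)) ≠ 0 :=
    Finset.prod_ne_zero_iff.2 fun j _ => (Real.exp_pos _).ne'
  exact (mul_eq_zero.1 (hli t)).resolve_right h1

/-- On a finite positive grid the ratio of two kernels grows at most exponentially in y, and Poisson
laws have all exponential moments. -/
theorem exists_regularKernel_kern {ϑ : Fin d → ℝ≥0} (hϑ : Function.Injective ϑ)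
    (hϑ_pos : ∀ i, 0 < ϑ i) :
    ∃ ρ : (Fin k → ℕ) → ℝ, RegularKernel (fun y (t : Fin k → Fin d) => kern y (gridPoint ϑ t)) ρ := by
  -- The sum dominates every ratio of grid values; the added 1 gives A ≥ 1, hence ρ ≥ 1, even for an
  -- empty grid.
  set A : ℝ≥0 := 1 + ∑ i, ∑ i', ϑ i / ϑ i' with hA
  set H : ℝ≥0 := ∑ i, ϑ i with hH
  have hH1 : ∀ i, ϑ i ≤ H := fun i => Finset.single_le_sum (fun _ _ => zero_le) (Finset.mem_univ i)
  have hA1 : ∀ i i', ϑ i ≤ A * ϑ i' := fun i i' => by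
    rw [← div_le_iff₀ (hϑ_pos i')]
    calc ϑ i / ϑ i' ≤ ∑ i', ϑ i / ϑ i' :=
          Finset.single_le_sum (f := fun i' => ϑ i / ϑ i') (fun _ _ => zero_le) (Finset.mem_univ i')
      _ ≤ ∑ i, ∑ i', ϑ i / ϑ i' :=
          Finset.single_le_sum (f := fun i => ∑ i', ϑ i / ϑ i') (fun _ _ => zero_le)
            (Finset.mem_univ i)
      _ ≤ A := le_add_self
  have hA0 : (1 : ℝ) ≤ A := by
    have : (1 : ℝ≥0) ≤ A := le_self_add
    exact_mod_cast this
  refine ⟨fun y => ∏ j, (Real.exp H * (A : ℝ) ^ y j), ?_, ?_, ?_, ?_, ?_, ?_⟩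
  · intro y t
    refine Finset.prod_pos fun j _ => ?_
    have : (0 : ℝ) < ϑ (t j) := hϑ_pos _
    simp only [gridPoint]
    positivity
  · intro y
    refine Finset.one_le_prod fun j _ => ?_
    exact one_le_mul_of_one_le_of_one_le (Real.one_le_exp H.coe_nonneg) (one_le_pow₀ hA0)
  · intro y t t'
    simp only [kern]
    rw [← Finset.prod_mul_distrib]
    refine Finset.prod_le_prod (fun j _ => by positivity) fun j _ => ?_
    simp only [gridPoint]
    have h1 : (ϑ (t j) : ℝ) ≤ A * ϑ (t' j) := by exact_mod_cast hA1 _ _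
    have h2 : Real.exp (-(ϑ (t j) : ℝ)) ≤ Real.exp H * Real.exp (-(ϑ (t' j) : ℝ)) := by
      rw [← Real.exp_add]
      have h3 : (ϑ (t' j) : ℝ) ≤ H := by exact_mod_cast hH1 _
      have h4 : (0 : ℝ) ≤ ϑ (t j) := NNReal.coe_nonneg _
      exact Real.exp_le_exp.2 (by linarith)
    calc _ ≤ Real.exp H * Real.exp (-(ϑ (t' j) : ℝ)) * (A * ϑ (t' j)) ^ y j /
          ((y j).factorial : ℝ) := by gcongr
      _ = _ := by rw [mul_pow]; ring
  · exact fun t => hasSum_kern _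
  · intro n t
    -- Exponential tilting: the Poisson mass with parameter θ times A ^ (n y) is a constant times
    -- the Poisson mass with parameter A ^ n θ.
    have h := (hasSum_kern fun j => A ^ n * gridPoint ϑ t j).summable.mul_right
      (∏ j, Real.exp H ^ n * Real.exp ((A : ℝ) ^ n * ϑ (t j) - ϑ (t j)))
    refine h.congr fun y => ?_
    simp only [kern]
    rw [← Finset.prod_pow, ← Finset.prod_mul_distrib, ← Finset.prod_mul_distrib]
    refine Finset.prod_congr rfl fun j _ => ?_
    simp only [gridPoint, NNReal.coe_mul, NNReal.coe_pow]
    have h1 : Real.exp (-(ϑ (t j) : ℝ)) = Real.exp (-((A : ℝ) ^ n * ϑ (t j))) *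
        Real.exp ((A : ℝ) ^ n * ϑ (t j) - ϑ (t j)) := by
      rw [← Real.exp_add]
      congr 1
      ring
    rw [h1]
    ring
  · exact fun v hv => eq_zero_of_mix_kern_eq_zero hϑ hv

theorem mixture_eq_mix (ϑ : Fin d → ℝ≥0) (g : (Fin k → Fin d) → ℝ) (y : Fin k → ℕ) :
    mixture ϑ g y = mix (fun y t => kern y (gridPoint ϑ t)) g y := rfl

theorem newton_eq_newtonSeq (ϑ : Fin d → ℝ≥0) (a : ℕ → ℝ) (g₀ : (Fin k → Fin d) → ℝ)
    (Y : ℕ → Fin k → ℕ) (n : ℕ) :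
    newton ϑ a g₀ Y n = newtonSeq (fun y t => kern y (gridPoint ϑ t)) a g₀ Y n := by
  induction n with
  | zero => rfl
  | succ n ih => simp only [newton, newtonSeq, ih]; rfl

/-- The regret is finite and bounded by a multiple of the Lyapunov function. -/
theorem exists_regret_le {ϑ : Fin d → ℝ≥0} {ρ : (Fin k → ℕ) → ℝ}
    (hK : RegularKernel (fun y (t : Fin k → Fin d) => kern y (gridPoint ϑ t)) ρ)
    {w : (Fin k → Fin d) → ℝ} (hw : IsPosPMF w) :
    ∃ C, ∀ g, IsPosPMF g → Summable (regretTerm ϑ g w) ∧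
      0 ≤ regret ϑ g w ∧ regret ϑ g w ≤ C * klExcess w g := by
  set H : ℝ := ∑ i, (ϑ i : ℝ) with hH
  have hH1 : ∀ i, (ϑ i : ℝ) ≤ H := fun i =>
    Finset.single_le_sum (f := fun i => (ϑ i : ℝ)) (fun _ _ => NNReal.coe_nonneg _)
      (Finset.mem_univ i)
  set N : ℝ := (Fintype.card (Fin k → Fin d) : ℝ) with hN
  set K : (Fin k → ℕ) → (Fin k → Fin d) → ℝ := fun y t => kern y (gridPoint ϑ t) with hKdef
  -- k coordinates, the square of the 2 H in `abs_mix_div_mix_sub_le`, N from Cauchy-Schwarz and 8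
  -- from `sum_sq_sub_le`.
  set B : ℝ := k * (4 * H ^ 2 * (N * 8)) with hB
  have hsum := hK.summable_mix_mul_pow w 2
  refine ⟨B * ∑' y, mix K w y * ρ y ^ 2, fun g hg => ?_⟩
  have hnn : ∀ y, 0 ≤ regretTerm ϑ g w y := fun y =>
    mul_nonneg (sq_nonneg _) (hK.mix_pos hw y).le
  have he : (∑ t, |g t - w t|) ^ 2 ≤ N * (8 * klExcess w g) := by
    have h1 : (∑ t, |g t - w t|) ^ 2 ≤ N * ∑ t, (w t - g t) ^ 2 := by
      have := sq_sum_le_card_mul_sum_sq (s := Finset.univ) (f := fun t => |g t - w t|)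
      simp only [sq_abs] at this
      rw [Finset.card_univ] at this
      simpa only [sub_sq_comm (w _)] using this
    have h2 := sum_sq_sub_le hw hg
    have h3 := one_sub_affinity_le_klExcess hw hg
    exact h1.trans (mul_le_mul_of_nonneg_left (by linarith) (Nat.cast_nonneg _))
  have hle : ∀ y, regretTerm ϑ g w y ≤ B * klExcess w g * (mix K w y * ρ y ^ 2) := by
    intro y
    have hcoord : ∀ j, (thetaHat ϑ g y - thetaHat ϑ w y) j ^ 2 ≤
        4 * H ^ 2 * (N * 8) * klExcess w g * ρ y ^ 2 := by
      intro j
      have h1 : |(thetaHat ϑ g y - thetaHat ϑ w y) j| ≤ 2 * H * (ρ y * ∑ t, |g t - w t|) := by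
        have h2 := hK.abs_mix_div_mix_sub_le hw hg (b := fun t => (ϑ (t j) : ℝ))
          (fun t => NNReal.coe_nonneg _) (fun t => hH1 _) y
        rw [PiLp.sub_apply, thetaHat_apply, thetaHat_apply]
        simpa only [mix, mixture, hKdef, mul_left_comm (kern y _)] using h2
      calc (thetaHat ϑ g y - thetaHat ϑ w y) j ^ 2
          = |(thetaHat ϑ g y - thetaHat ϑ w y) j| ^ 2 := (sq_abs _).symm
        _ ≤ (2 * H * (ρ y * ∑ t, |g t - w t|)) ^ 2 := pow_le_pow_left₀ (abs_nonneg _) h1 2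
        _ = 4 * H ^ 2 * ρ y ^ 2 * (∑ t, |g t - w t|) ^ 2 := by ring
        _ ≤ 4 * H ^ 2 * ρ y ^ 2 * (N * (8 * klExcess w g)) := by gcongr
        _ = _ := by ring
    rw [regretTerm, EuclideanSpace.real_norm_sq_eq, mixture_eq_mix]
    have h2 : ∑ j, (thetaHat ϑ g y - thetaHat ϑ w y) j ^ 2 ≤
        k * (4 * H ^ 2 * (N * 8) * klExcess w g * ρ y ^ 2) := by
      have := Finset.sum_le_card_nsmul Finset.univ _ _ fun j _ => hcoord j
      simpa using this
    calc _ ≤ k * (4 * H ^ 2 * (N * 8) * klExcess w g * ρ y ^ 2) * mix K w y :=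
          mul_le_mul_of_nonneg_right h2 (hK.mix_pos hw y).le
      _ = _ := by rw [hB]; ring
  have hsum' := hsum.mul_left (B * klExcess w g)
  have hS := Summable.of_nonneg_of_le hnn hle hsum'
  refine ⟨hS, tsum_nonneg hnn, ?_⟩
  calc regret ϑ g w ≤ ∑' y, B * klExcess w g * (mix K w y * ρ y ^ 2) := hS.tsum_le_tsum hle hsum'
    _ = _ := by rw [tsum_mul_left]; ring

/-! ### The oracle prior and the law of the observations. -/

section Model

variable {ϑ : Fin d → ℝ≥0} {G : Measure (Fin k → ℝ≥0)}

theorem measure_compl_range_gridPoint (hG : G.support = Set.range (gridPoint ϑ)) :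
    G (Set.range (gridPoint ϑ : (Fin k → Fin d) → Fin k → ℝ≥0))ᶜ = 0 := by
  rw [← hG]
  exact Measure.measure_compl_support

theorem lintegral_eq_sum_gridPoint (hϑ : Function.Injective ϑ)
    (hG : G.support = Set.range (gridPoint ϑ)) (f : (Fin k → ℝ≥0) → ENNReal) :
    ∫⁻ x, f x ∂G = ∑ t, f (gridPoint ϑ t) * G {gridPoint ϑ t} := by
  classical
  have h : ((Finset.univ.image (gridPoint ϑ : (Fin k → Fin d) → Fin k → ℝ≥0) : Finset _) :
      Set (Fin k → ℝ≥0)) = Set.range (gridPoint ϑ) := by simp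
  have hres : G.restrict (Set.range (gridPoint ϑ : (Fin k → Fin d) → Fin k → ℝ≥0)) = G :=
    Measure.restrict_eq_self_of_ae_mem (measure_compl_range_gridPoint hG)
  conv_lhs => rw [← hres]
  rw [← h, lintegral_finset, Finset.sum_image (gridPoint_injective hϑ).injOn]

theorem isPosPMF_priorPMF [IsProbabilityMeasure G] (hϑ : Function.Injective ϑ)
    (hG : G.support = Set.range (gridPoint ϑ)) :
    IsPosPMF (priorPMF ϑ G : (Fin k → Fin d) → ℝ) where
  pos t := by
    -- Removing the other, finitely many, grid points leaves a neighbourhood of a point of the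
    -- support, so of positive mass; off the grid `G` is null, so the mass sits at that point.
    have hfin : (Set.range (gridPoint ϑ : (Fin k → Fin d) → Fin k → ℝ≥0) \
        {gridPoint ϑ t}).Finite := (Set.finite_range _).subset Set.sdiff_subset
    have hmem : gridPoint ϑ t ∈ G.support := hG ▸ Set.mem_range_self t
    have hpos := (Measure.mem_support_iff_forall _).1 hmem _
      (hfin.isClosed.isOpen_compl.mem_nhds (by simp))
    refine ENNReal.toReal_pos (fun h0 => hpos.ne' ?_) (measure_ne_top _ _)
    refine measure_mono_null (t := {gridPoint ϑ t} ∪ (Set.range (gridPoint ϑ))ᶜ) ?_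
      (measure_union_null h0 (measure_compl_range_gridPoint hG))
    intro x hx
    simp only [Set.mem_compl_iff, Set.mem_sdiff, Set.mem_singleton_iff, not_and, not_not] at hx
    by_cases hxr : x ∈ Set.range (gridPoint ϑ : (Fin k → Fin d) → Fin k → ℝ≥0)
    · exact Or.inl (hx hxr)
    · exact Or.inr hxr
  sum_eq_one := by
    have h := lintegral_eq_sum_gridPoint hϑ hG fun _ => 1
    simp only [lintegral_one, measure_univ, one_mul] at h
    have h1 := congrArg ENNReal.toReal h
    rw [ENNReal.toReal_sum fun t _ => measure_ne_top _ _, ENNReal.toReal_one] at h1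
    exact h1.symm

theorem IsTrueModel.measure_preimage_singleton [IsProbabilityMeasure G] {Ω : Type*}
    [MeasurableSpace Ω] {P : Measure Ω} {θ : ℕ → Ω → Fin k → ℝ≥0} {Y : ℕ → Ω → Fin k → ℕ}
    (hmodel : IsTrueModel P G θ Y) (hϑ : Function.Injective ϑ)
    (hG : G.support = Set.range (gridPoint ϑ)) (n : ℕ) (y : Fin k → ℕ) :
    P (Y n ⁻¹' {y}) = ENNReal.ofReal
      (mix (fun y t => kern y (gridPoint ϑ t)) (priorPMF ϑ G) y) := by
  have h := hmodel.cond_obs n Set.univ MeasurableSet.univ {y}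
  rw [Set.preimage_univ, Set.univ_inter, Measure.restrict_univ,
    lintegral_eq_sum_gridPoint hϑ hG] at h
  have hnn : ∀ t ∈ Finset.univ, 0 ≤ kern y (gridPoint ϑ t) * priorPMF ϑ G t := fun t _ =>
    mul_nonneg (kern_nonneg _ _) measureReal_nonneg
  rw [h, mix, ENNReal.ofReal_sum_of_nonneg hnn]
  refine Finset.sum_congr rfl fun t _ => ?_
  rw [ENNReal.ofReal_mul (kern_nonneg _ _), pi_poissonMeasure_singleton, priorPMF,
    ofReal_measureReal]

end Model

end PoissonCompound

end

open PoissonCompound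
theorem mainTheorem5 {k d : ℕ}
    (ϑ : Fin d → ℝ≥0) (hϑ : StrictMono ϑ) (hϑ_pos : ∀ i, 0 < ϑ i)
    (G : Measure (Fin k → ℝ≥0)) [IsProbabilityMeasure G]
    (hG : G.support = Set.range (gridPoint ϑ))
    {Ω : Type*} [MeasurableSpace Ω] (P : Measure Ω) [IsProbabilityMeasure P]
    (θ : ℕ → Ω → Fin k → ℝ≥0) (Y : ℕ → Ω → Fin k → ℕ) (hmodel : IsTrueModel P G θ Y)
    (g₀ : (Fin k → Fin d) → ℝ) (hg₀_pos : ∀ t, 0 < g₀ t) (hg₀_sum : ∑ t, g₀ t = 1)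
    (α : ℝ) (hα : 0 < α) (γ : ℝ) (hγ : γ ∈ Set.Ioo (1 / 2 : ℝ) 1)
    (δ : ℝ) (hδ : δ < 2 - 1 / γ) :
    ∀ᵐ ω ∂P,
      (∀ n, Summable (regretTerm ϑ
        (newton ϑ (fun m : ℕ => (α + m) ^ (-γ)) g₀ (fun i => Y i ω) n) (priorPMF ϑ G))) ∧
      (fun n : ℕ => regret ϑ
        (newton ϑ (fun m : ℕ => (α + m) ^ (-γ)) g₀ (fun i => Y i ω) n) (priorPMF ϑ G))
        =o[atTop] (fun n : ℕ => (n : ℝ) ^ (-δ)) := by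
  have hinj := hϑ.injective
  have hγ0 : 0 < γ := by linarith [hγ.1]
  have hδγ : δ < γ := by
    -- The almost sure rate is available for every exponent below γ, which covers the stated range.
    have h1 : 2 - 1 / γ ≤ γ := by
      have h2 : γ - (2 - 1 / γ) = (γ - 1) ^ 2 / γ := by
        field_simp
        ring
      have h3 : 0 ≤ (γ - 1) ^ 2 / γ := by positivity
      linarith
    linarith
  obtain ⟨ρ, hK⟩ := exists_regularKernel_kern (k := k) hinj hϑ_pos
  have hw : IsPosPMF (priorPMF ϑ G : (Fin k → Fin d) → ℝ) := isPosPMF_priorPMF hinj hG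
  have hg₀ : IsPosPMF g₀ := ⟨hg₀_pos, hg₀_sum⟩
  obtain ⟨C, hC⟩ := exists_regret_le hK hw
  have hrate := hK.ae_tendsto_rpow_mul_klExcess hw hg₀ hmodel.measurable_obs hmodel.indep_obs
    (hmodel.measure_preimage_singleton hinj hG) hα hγ0 hγ.2 hδγ
  filter_upwards [hrate] with ω hω
  simp only [newton_eq_newtonSeq]
  have hpmf := hK.isPosPMF_newtonSeq (a := fun m : ℕ => (α + m) ^ (-γ)) hg₀
    (fun n => rate_pos hα (n + 1))
    (fun n => (rate_succ_le hα hγ0 n).trans_lt (rate_one_lt_one hα hγ0)) fun i => Y i ω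
  refine ⟨fun n => (hC _ (hpmf n)).1, ?_⟩
  refine (isLittleO_iff_tendsto' ?_).2 ?_
  -- At n = 0 the power n ^ (-δ) may vanish, so nonvanishing is only claimed eventually.
  · filter_upwards [eventually_gt_atTop 0] with n hn h0
    exact absurd h0 (Real.rpow_pos_of_pos (Nat.cast_pos.2 hn) _).ne'
  · have hC' := hω.const_mul C
    rw [mul_zero] at hC'
    refine squeeze_zero (fun n => div_nonneg (hC _ (hpmf n)).2.1 (by positivity)) (fun n => ?_) hC'
    rw [Real.rpow_neg n.cast_nonneg, div_inv_eq_mul]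
    calc _ ≤ C * klExcess _ _ * (n : ℝ) ^ δ :=
          mul_le_mul_of_nonneg_right (hC _ (hpmf n)).2.2 (by positivity)
      _ = _ := by ring
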